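/- For $N\ge 1$ let $P_N$ be the joint law of the eigenvalues $z_1,\dots,z_N$ of the complex Ginibre ensemble (independent complex Gaussian entries of mean $0$ and variance $1/N$), that is, the probability measure on $\mathbb{C}^N$ $$dP_N(z_1,\dots,z_N)=\frac1{Z_N}\prod_{1\le l<k\le N}|z_l-z_k|^2\,\prod_{k=1}^N e^{-N|z_k|^2}\,d\Re(z_k)\,d\Im(z_k),$$ let $\#\mathcal I[a,b]$ be the number of indices $k$ with $|z_k|\in[a,b]$, and let $\mathrm{Var}_N$ denote the variance under $P_N$. For $c\ge 0$ put $$I_{mod}(c)=\sqrt{\pi}\int_{-\infty}^{\infty}\bigl(q_c(x)-q_c(x)^2\bigr)\,dx,\qquad q_c(x)=\int_x^{2c+x}e^{-t^2/2}\,\frac{dt}{\sqrt{2\pi}} .$$ (1) For fixed $0<a<b<1$, as $N\to\infty$, $$\mathrm{Var}_N\bigl(\#\mathcal I[a,b]\bigr)=\sqrt N\,\frac{a+b}{\sqrt\pi}+O(1).$$ (2) Let $a=a_N$ and $b=b_N$ be such that $a_N$ converges to a point of $(0,1)$ (for example, $a_N$ is a constant in $(0,1)$), $b_N-a_N\to0$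 and $N(b_N-a_N)\to\infty$. Then, as $N\to\infty$: (i) if $\sqrt N(b-a)\to\infty$, then $\mathrm{Var}_N(\#\mathcal I[a,b])=\sqrt N\,\frac{2a}{\sqrt\pi}\,(1+o(1))$; (ii) if $\sqrt N(b-a)\to c$ with $0<c<\infty$, then $\mathrm{Var}_N(\#\mathcal I[a,b])=\sqrt N\,\frac{a}{\sqrt\pi}\,I_{mod}\bigl(\sqrt N(b-a)\bigr)+O(1)$ and $\mathrm{Var}_N(\#\mathcal I[a,b])=\sqrt N\,\frac{a}{\sqrt\pi}\,I_{mod}(c)\,(1+o(1))$; if moreover $\sqrt N(b-a)=c+O(N^{-1/2})$, in particular if $b=a+c/\sqrt N$, then $\mathrm{Var}_N(\#\mathcal I[a,b])=\sqrt N\,\frac{a}{\sqrt\pi}\,I_{mod}(c)+O(1)$; (iii) if $\sqrt N(b-a)\to0$, then $\mathrm{Var}_N(\#\mathcal I[a,b])=N(b^2-a^2)(1+o(1))$. (3) The integral defining $I_{mod}(c)$ converges and $I_{mod}(c)\ge0$ for every $c\ge0$; moreover $\lim_{c\downarrow0}I_{mod}(c)=0$ and $\lim_{c\uparrow\infty}I_{mod}(c)=2$.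 -/

import Mathlib

open MeasureTheory ProbabilityTheory Filter Asymptotics Topology

noncomputable section

/-- The weight `μ_N(dz) = exp (-N |z|²) d(Re z) d(Im z)` on the complex plane. -/
def ginibreWeight (N : ℕ) : Measure ℂ :=
  (volume : Measure ℂ).withDensity fun z => ENNReal.ofReal (Real.exp (-(N : ℝ) * ‖z‖ ^ 2))

/-- The squared Vandermonde factor `∏_{l < k} |z_l - z_k|²`. -/
def vandermondeSq (N : ℕ) (z : Fin N → ℂ) : ℝ :=
  ∏ l : Fin N, ∏ k ∈ Finset.Ioi l, ‖z l - z k‖ ^ 2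

/-- The unnormalized joint law of the eigenvalues,
`∏_{l < k} |z_l - z_k|² μ_N(dz_1) ⋯ μ_N(dz_N)`. -/
def ginibreUnnormalized (N : ℕ) : Measure (Fin N → ℂ) :=
  (Measure.pi fun _ : Fin N => ginibreWeight N).withDensity
    fun z => ENNReal.ofReal (vandermondeSq N z)

/-- The joint law `P_N` of the eigenvalues of the complex Ginibre ensemble (entries of
variance `1 / N`): the unnormalized law divided by its total mass `Z_N`. -/
def ginibreLaw (N : ℕ) : Measure (Fin N → ℂ) :=
  (ginibreUnnormalized N Set.univ)⁻¹ • ginibreUnnormalized N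

/-- The linear statistic `X(f) = ∑_k f(z_k)`. -/
def linearStatistic (N : ℕ) (f : ℂ → ℝ) (z : Fin N → ℂ) : ℝ :=
  ∑ k, f (z k)

/-- The number of the points `z_1, …, z_N` (with multiplicity) with modulus in `[a, b]`. -/
def modulusCount (N : ℕ) (a b : ℝ) : (Fin N → ℂ) → ℝ :=
  linearStatistic N (Set.indicator {w : ℂ | ‖w‖ ∈ Set.Icc a b} fun _ => 1)

/-- The variance under `P_N` of the number of eigenvalues with modulus in `[a, b]`. -/
def modulusVar (N : ℕ) (a b : ℝ) : ℝ :=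
  variance (modulusCount N a b) (ginibreLaw N)

/-- The standard Gaussian mass of the window `[x, 2c + x]`, for `c ≥ 0`. -/
def gaussWindow (c x : ℝ) : ℝ :=
  ∫ t in x..(2 * c + x), Real.exp (-t ^ 2 / 2) / √(2 * Real.pi)

/-- `I_mod(c) = √π ∫ (q_c(x) - q_c(x)²) dx`, with `q_c(x)` the standard Gaussian mass of
`[x, 2c + x]`. -/
def Imod (c : ℝ) : ℝ :=
  √Real.pi * ∫ x : ℝ, (gaussWindow c x - gaussWindow c x ^ 2)

end

/-!
By Andréief's identity the law `P_N` is determinantal for the monomials `z ^ k`, which are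
orthogonal on every annulus; hence (Kostlan) the count on an annulus has the law of a sum of
independent Bernoulli variables, the `k`-th one asking whether a variable with the
`Gamma (k + 1, N)` law lies in `[a ^ 2, b ^ 2]`. Its parameter `p_k` is a difference of two
Poisson distribution functions at `k`, of parameters `N a ^ 2` and `N b ^ 2`, so up to an `O(1)`
tail the variance `∑ p_k (1 - p_k)` is expressed by the mean absolute differences `E |X - Y|` of
Poisson variables. Writing `E |X|` as an integral of the characteristic function of `X` shows that
replacing a difference of Poisson variables by a Gaussian variable of the same mean and variance
changes `E |X|` by a bounded amount. The resulting Gaussian main term is explicit, with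
`E min (m, σ |Z|)` as its only transcendental ingredient, and the same function gives `I_mod`.
-/

section Andreief

variable {ι α 𝕜 : Type*} [Fintype ι] [DecidableEq ι] [RCLike 𝕜]

theorem det_mul_det_eq_sum_perm (φ ψ : ι → α → 𝕜) (x : ι → α) :
    (Matrix.of fun i j => φ i (x j)).det * (Matrix.of fun i j => ψ i (x j)).det =
      ∑ σ : Equiv.Perm ι, ∑ τ : Equiv.Perm ι, ((σ.sign : ℤ) : 𝕜) * ((τ.sign : ℤ) : 𝕜) *
        ∏ i, φ (σ i) (x i) * ψ (τ i) (x i) := by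
  simp only [Matrix.det_apply', Matrix.of_apply, Finset.sum_mul_sum, Finset.prod_mul_distrib]
  refine Finset.sum_congr rfl fun σ _ => Finset.sum_congr rfl fun τ _ => ?_
  ring

variable [MeasurableSpace α] {μ : Measure α} [SigmaFinite μ] {φ ψ : ι → α → 𝕜}

theorem integrable_prod_perm_mul (h : ∀ i j, Integrable (fun y => φ i y * ψ j y) μ)
    (σ τ : Equiv.Perm ι) :
    Integrable (fun x : ι → α => ((σ.sign : ℤ) : 𝕜) * ((τ.sign : ℤ) : 𝕜) *
      ∏ i, φ (σ i) (x i) * ψ (τ i) (x i)) (Measure.pi fun _ => μ) :=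
  (Integrable.fintype_prod (f := fun i y => φ (σ i) y * ψ (τ i) y)
    fun i => h (σ i) (τ i)).const_mul _

theorem sum_perm_sign_mul_prod_eq (A : Matrix ι ι 𝕜) :
    ∑ σ : Equiv.Perm ι, ∑ τ : Equiv.Perm ι,
      ((σ.sign : ℤ) : 𝕜) * ((τ.sign : ℤ) : 𝕜) * ∏ i, A (σ i) (τ i) =
      (Fintype.card ι).factorial * A.det := by
  have h_inner (σ : Equiv.Perm ι) : ∑ τ : Equiv.Perm ι,
      ((σ.sign : ℤ) : 𝕜) * ((τ.sign : ℤ) : 𝕜) * ∏ i, A (σ i) (τ i) = A.det := by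
    have h_sign : ((σ.sign : ℤ) : 𝕜) * ((σ.sign : ℤ) : 𝕜) = 1 := by
      rw [← Int.cast_mul, Int.units_coe_mul_self, Int.cast_one]
    simp only [mul_assoc, ← Finset.mul_sum]
    rw [← one_mul A.det, ← h_sign, mul_assoc, ← Matrix.det_permute, ← Matrix.det_transpose,
      Matrix.det_apply']
    rfl
  rw [Finset.sum_congr rfl fun σ _ => h_inner σ, Finset.sum_const, Finset.card_univ,
    Fintype.card_perm, nsmul_eq_mul]

theorem integral_det_mul_det (h : ∀ i j, Integrable (fun y => φ i y * ψ j y) μ) :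
    ∫ x : ι → α, (Matrix.of fun i j => φ i (x j)).det * (Matrix.of fun i j => ψ i (x j)).det
      ∂(Measure.pi fun _ => μ) =
      (Fintype.card ι).factorial * (Matrix.of fun i j => ∫ y, φ i y * ψ j y ∂μ).det := by
  simp only [det_mul_det_eq_sum_perm]
  rw [integral_finsetSum _ fun σ _ => integrable_finsetSum _ fun τ _ =>
    integrable_prod_perm_mul h σ τ, ← sum_perm_sign_mul_prod_eq]
  refine Finset.sum_congr rfl fun σ _ => ?_
  rw [integral_finsetSum _ fun τ _ => integrable_prod_perm_mul h σ τ]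
  refine Finset.sum_congr rfl fun τ _ => ?_
  rw [integral_const_mul, integral_fintype_prod_eq_prod fun i y => φ (σ i) y * ψ (τ i) y]
  rfl

end Andreief

section GinibreWeight

variable {E : Type*} [NormedAddCommGroup E] [NormedSpace ℝ E]

theorem integral_ginibreWeight (N : ℕ) (g : ℂ → E) :
    ∫ z, g z ∂ginibreWeight N = ∫ z, Real.exp (-(N : ℝ) * ‖z‖ ^ 2) • g z := by
  rw [ginibreWeight, integral_withDensity_eq_integral_toReal_smul (by fun_prop) (by simp)]
  simp only [ENNReal.toReal_ofReal (Real.exp_nonneg _)]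

theorem integrable_ginibreWeight_iff (N : ℕ) (g : ℂ → E) :
    Integrable g (ginibreWeight N) ↔
      Integrable (fun z => Real.exp (-(N : ℝ) * ‖z‖ ^ 2) • g z) := by
  rw [ginibreWeight, integrable_withDensity_iff_integrable_smul' (by fun_prop) (by simp)]
  simp only [ENNReal.toReal_ofReal (Real.exp_nonneg _)]

instance sigmaFinite_ginibreWeight (N : ℕ) : SigmaFinite (ginibreWeight N) := by
  unfold ginibreWeight; infer_instance

theorem integral_ginibreWeight_comp_circle_mul (N : ℕ) (u : Circle) (g : ℂ → E) :
    ∫ z, g (u * z) ∂ginibreWeight N = ∫ z, g z ∂ginibreWeight N := by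
  rw [integral_ginibreWeight, integral_ginibreWeight]
  have h := (rotation u).measurePreserving.integral_comp
    (rotation u).toHomeomorph.measurableEmbedding
    (fun z => Real.exp (-(N : ℝ) * ‖z‖ ^ 2) • g z)
  simpa only [rotation_apply, norm_mul, Circle.norm_coe, one_mul] using h

theorem exists_circle_pow_mul_conj_pow_ne_one {m n : ℕ} (h : m ≠ n) :
    ∃ u : Circle, (u : ℂ) ^ m * (starRingEnd ℂ (u : ℂ)) ^ n ≠ 1 := by
  have h_sub : (m : ℂ) - n ≠ 0 := sub_ne_zero.mpr (Nat.cast_injective.ne h)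
  refine ⟨Circle.exp (Real.pi / (m - n)), ?_⟩
  have h_eq : (Circle.exp (Real.pi / (m - n)) : ℂ) ^ m *
      (starRingEnd ℂ (Circle.exp (Real.pi / (m - n)) : ℂ)) ^ n = -1 := by
    rw [Circle.coe_exp, ← Complex.exp_conj, ← Complex.exp_nat_mul, ← Complex.exp_nat_mul,
      ← Complex.exp_add, ← Complex.exp_pi_mul_I]
    congr 1
    simp only [map_mul, Complex.conj_ofReal, Complex.conj_I]
    push_cast
    field_simp
    ring
  rw [h_eq]
  norm_num

theorem integral_pow_mul_conj_pow_mul_radial_of_ne (N : ℕ) {m n : ℕ} (hmn : m ≠ n) (h : ℝ → ℂ) :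
    ∫ z : ℂ, z ^ m * (starRingEnd ℂ z ^ n * h (‖z‖ ^ 2)) ∂ginibreWeight N = 0 := by
  obtain ⟨u, hu⟩ := exists_circle_pow_mul_conj_pow_ne_one hmn
  set c : ℂ := (u : ℂ) ^ m * (starRingEnd ℂ (u : ℂ)) ^ n with hc
  have h_rot := integral_ginibreWeight_comp_circle_mul N u
    (fun z : ℂ => z ^ m * (starRingEnd ℂ z ^ n * h (‖z‖ ^ 2)))
  have h_factor (z : ℂ) : (u * z) ^ m * (starRingEnd ℂ (u * z) ^ n * h (‖u * z‖ ^ 2)) =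
      c * (z ^ m * (starRingEnd ℂ z ^ n * h (‖z‖ ^ 2))) := by
    simp only [hc, map_mul, norm_mul, Circle.norm_coe, one_mul]
    ring
  simp only [h_factor, integral_const_mul] at h_rot
  by_contra h_ne
  exact hu (mul_right_cancel₀ h_ne (by rw [h_rot, one_mul]))

theorem integral_comp_norm_sq (F : ℝ → E) :
    ∫ z : ℂ, F (‖z‖ ^ 2) = Real.pi • ∫ x in Set.Ioi (0 : ℝ), F x := by
  rw [integral_fun_norm_addHaar volume fun y => F (y ^ 2),
    ← integral_comp_rpow_Ioi_of_pos (g := F) (p := 2) two_pos, measureReal_def, Complex.volume_ball]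
  simp only [Complex.finrank_real_complex, ENNReal.ofReal_one, one_pow, one_mul,
    ENNReal.coe_toReal, NNReal.coe_real_pi]
  rw [← Nat.cast_smul_eq_nsmul ℝ, smul_comm, ← integral_smul]
  norm_num [smul_smul]

theorem integrable_norm_pow_ginibreWeight (N m : ℕ) [NeZero N] :
    Integrable (fun z : ℂ => ‖z‖ ^ m) (ginibreWeight N) := by
  rw [integrable_ginibreWeight_iff,
    integrable_fun_norm_addHaar volume (f := fun y : ℝ => Real.exp (-(N : ℝ) * y ^ 2) • y ^ m)]
  refine (integrableOn_rpow_mul_exp_neg_mul_sq (b := N) (Nat.cast_pos.mpr (NeZero.pos N))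
    (s := (m + 1 : ℕ)) (by push_cast; linarith [m.cast_nonneg (α := ℝ)])).congr_fun
    (fun y _ => ?_) measurableSet_Ioi
  simp only [Complex.finrank_real_complex, smul_eq_mul, Real.rpow_natCast]
  ring

theorem integrable_pow_mul_conj_pow_mul_radial (N : ℕ) [NeZero N] (m n : ℕ) {h : ℝ → ℂ} {C : ℝ}
    (hm : Measurable h) (hC : ∀ x, ‖h x‖ ≤ C) :
    Integrable (fun z : ℂ => z ^ m * (starRingEnd ℂ z ^ n * h (‖z‖ ^ 2))) (ginibreWeight N) := by
  refine ((integrable_norm_pow_ginibreWeight N (m + n)).mul_const C).mono' ?_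
    (ae_of_all _ fun z => ?_)
  · have h_conj : Measurable (starRingEnd ℂ) := Complex.continuous_conj.measurable
    fun_prop
  · simp only [norm_mul, norm_pow, RCLike.norm_conj, pow_add, ← mul_assoc]
    gcongr
    exact hC _

end GinibreWeight

section Gamma

variable {E : Type*} [NormedAddCommGroup E] [NormedSpace ℝ E]

theorem integral_gammaMeasure_nat_add_one (k : ℕ) {r : ℝ} (hr : 0 ≤ r) (f : ℝ → E) :
    ∫ x, f x ∂gammaMeasure (k + 1) r =
      ∫ x in Set.Ioi 0, (r ^ (k + 1) / k.factorial * (x ^ k * Real.exp (-(r * x)))) • f x := by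
  have h_pdf : gammaPDFReal (k + 1) r = (Set.Ici 0).indicator
      fun x => r ^ (k + 1) / k.factorial * (x ^ k * Real.exp (-(r * x))) := by
    ext x
    by_cases hx : 0 ≤ x
    · rw [Set.indicator_of_mem (Set.mem_Ici.mpr hx), gammaPDFReal, if_pos hx,
        Real.Gamma_nat_eq_factorial, add_sub_cancel_right, Real.rpow_natCast, mul_assoc]
      norm_cast
    · rw [Set.indicator_of_notMem (mt Set.mem_Ici.mp hx), gammaPDFReal, if_neg hx]
  have h_nonneg (x : ℝ) : 0 ≤ gammaPDFReal (k + 1) r x := by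
    rw [h_pdf]
    exact Set.indicator_nonneg (fun y (hy : 0 ≤ y) => by positivity) x
  rw [gammaMeasure, integral_withDensity_eq_integral_toReal_smul
    (f := gammaPDF (k + 1) r) (measurable_gammaPDFReal _ _).ennreal_ofReal
    (ae_of_all _ fun _ => ENNReal.ofReal_lt_top),
    ← integral_Ici_eq_integral_Ioi, ← integral_indicator measurableSet_Ici]
  simp only [gammaPDF, ENNReal.toReal_ofReal (h_nonneg _)]
  simp only [h_pdf, Set.indicator_smul_left]

instance isProbabilityMeasure_gammaMeasure_nat_add_one (k N : ℕ) [NeZero N] :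
    IsProbabilityMeasure (gammaMeasure (k + 1) N) :=
  isProbabilityMeasure_gammaMeasure (by positivity) (Nat.cast_pos.mpr (NeZero.pos N))

/-- The Poisson distribution function `e^{-x} ∑_{i ≤ k} x^i / i!`, as a function of the real
parameter `x`. -/
noncomputable def poissonCdf (k : ℕ) (x : ℝ) : ℝ :=
  Real.exp (-x) * ∑ i ∈ Finset.range (k + 1), x ^ i / (i.factorial : ℝ)

theorem poissonCdf_succ (k : ℕ) (x : ℝ) : poissonCdf (k + 1) x =
    poissonCdf k x + Real.exp (-x) * (x ^ (k + 1) / ((k + 1).factorial : ℝ)) := by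
  rw [poissonCdf, poissonCdf, Finset.sum_range_succ _ (k + 1), mul_add]

theorem hasDerivAt_poissonCdf (k : ℕ) (x : ℝ) :
    HasDerivAt (poissonCdf k) (-(Real.exp (-x) * (x ^ k / (k.factorial : ℝ)))) x := by
  induction k with
  | zero =>
    have h_exp : poissonCdf 0 = fun y => Real.exp (-y) := by
      ext y
      simp [poissonCdf]
    simpa [h_exp] using (hasDerivAt_neg x).exp
  | succ k ih =>
    rw [funext (poissonCdf_succ k)]
    refine (ih.add ((hasDerivAt_neg x).exp.mul
      ((hasDerivAt_pow (k + 1) x).div_const ((k + 1).factorial : ℝ)))).congr_deriv ?_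
    rw [Nat.factorial_succ]
    push_cast
    field_simp
    ring

theorem hasDerivAt_poissonCdf_const_mul (k : ℕ) (r x : ℝ) :
    HasDerivAt (fun x => -poissonCdf k (r * x))
      (r ^ (k + 1) / k.factorial * (x ^ k * Real.exp (-(r * x)))) x := by
  refine (((hasDerivAt_poissonCdf k (r * x)).comp x ((hasDerivAt_id x).const_mul r)).neg)
    |>.congr_deriv ?_
  ring

theorem gammaMeasure_real_Icc (k : ℕ) {r x y : ℝ} (hr : 0 ≤ r) (hx : 0 ≤ x) (hxy : x ≤ y) :
    (gammaMeasure (k + 1) r).real (Set.Icc x y) = poissonCdf k (r * x) - poissonCdf k (r * y) := by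
  rw [← integral_indicator_one measurableSet_Icc, integral_gammaMeasure_nat_add_one k hr]
  have h_indicator (z : ℝ) : (r ^ (k + 1) / k.factorial * (z ^ k * Real.exp (-(r * z)))) •
      (Set.Icc x y).indicator (1 : ℝ → ℝ) z = (Set.Icc x y).indicator
        (fun z => r ^ (k + 1) / k.factorial * (z ^ k * Real.exp (-(r * z)))) z := by
    simp [Set.indicator_apply]
  simp only [h_indicator]
  rw [← integral_Ici_eq_integral_Ioi, setIntegral_indicator measurableSet_Icc,
    Set.inter_eq_right.mpr (Set.Icc_subset_Ici_iff hxy |>.mpr hx),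
    integral_Icc_eq_integral_Ioc, ← intervalIntegral.integral_of_le hxy,
    intervalIntegral.integral_eq_sub_of_hasDerivAt
      (fun z _ => hasDerivAt_poissonCdf_const_mul k r z)
      (Continuous.intervalIntegrable (by fun_prop) _ _)]
  ring

theorem integral_norm_pow_mul_ginibreWeight (N k : ℕ) [NeZero N] (h : ℝ → ℂ) :
    ∫ z : ℂ, ((‖z‖ : ℂ) ^ 2) ^ k * h (‖z‖ ^ 2) ∂ginibreWeight N =
      (Real.pi * k.factorial / (N : ℂ) ^ (k + 1)) * ∫ x, h x ∂gammaMeasure (k + 1) N := by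
  have h_polar := integral_comp_norm_sq
    fun x => Real.exp (-(N : ℝ) * x) • ((x : ℂ) ^ k * h x)
  push_cast at h_polar
  rw [integral_ginibreWeight, h_polar, integral_gammaMeasure_nat_add_one k N.cast_nonneg]
  simp only [Complex.real_smul]
  rw [← integral_const_mul, ← integral_const_mul]
  refine setIntegral_congr_fun measurableSet_Ioi fun x _ => ?_
  have h_factorial : (k.factorial : ℂ) ≠ 0 := Nat.cast_ne_zero.mpr k.factorial_ne_zero
  have h_N : (N : ℂ) ≠ 0 := NeZero.ne _
  push_cast
  field_simp

end Gamma

section Kostlan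

theorem variance_indicator_one {Ω : Type*} [MeasurableSpace Ω] (μ : Measure Ω)
    [IsProbabilityMeasure μ] {s : Set Ω} (hs : MeasurableSet s) :
    variance (s.indicator 1) μ = μ.real s * (1 - μ.real s) := by
  rw [variance_eq_sub (X := s.indicator 1)
    (memLp_indicator_const 2 hs 1 (Or.inr (measure_ne_top μ s)))]
  have h_sq : (s.indicator (1 : Ω → ℝ)) ^ 2 = s.indicator 1 := by
    ext ω
    by_cases hω : ω ∈ s <;> simp [hω]
  rw [h_sq, integral_indicator_one hs]
  ring

theorem vandermondeSq_nonneg (N : ℕ) (z : Fin N → ℂ) : 0 ≤ vandermondeSq N z :=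
  Finset.prod_nonneg fun _ _ => Finset.prod_nonneg fun _ _ => by positivity

theorem measurable_vandermondeSq (N : ℕ) : Measurable (vandermondeSq N) := by
  unfold vandermondeSq
  fun_prop

theorem ofReal_vandermondeSq_mul_prod (N : ℕ) (h : ℝ → ℂ) (z : Fin N → ℂ) :
    (vandermondeSq N z : ℂ) * ∏ k, h (‖z k‖ ^ 2) =
      (Matrix.of fun i j : Fin N => z j ^ (i : ℕ)).det *
        (Matrix.of fun i j : Fin N => starRingEnd ℂ (z j) ^ (i : ℕ) * h (‖z j‖ ^ 2)).det := by
  have h_vandermonde : (Matrix.of fun i j : Fin N => z j ^ (i : ℕ)).det =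
      (Matrix.vandermonde z).det := by
    rw [← Matrix.det_transpose]
    rfl
  have h_conj :
      (Matrix.of fun i j : Fin N => starRingEnd ℂ (z j) ^ (i : ℕ) * h (‖z j‖ ^ 2)).det =
      (∏ k, h (‖z k‖ ^ 2)) * starRingEnd ℂ (Matrix.vandermonde z).det := by
    rw [RingHom.map_det, ← Matrix.det_transpose (RingHom.mapMatrix _ _), ← Matrix.det_mul_row]
    congr with i j
    simp [mul_comm]
  rw [h_vandermonde, h_conj, mul_comm (∏ k, h _), ← mul_assoc, Complex.mul_conj,
    Complex.normSq_eq_norm_sq, Matrix.det_vandermonde, vandermondeSq]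
  simp only [norm_prod, ← Finset.prod_pow, norm_sub_rev]

theorem integral_ginibreUnnormalized (N : ℕ) (g : (Fin N → ℂ) → ℂ) :
    ∫ z, g z ∂ginibreUnnormalized N =
      ∫ z, (vandermondeSq N z : ℂ) * g z ∂(Measure.pi fun _ => ginibreWeight N) := by
  rw [ginibreUnnormalized, integral_withDensity_eq_integral_toReal_smul
    (measurable_vandermondeSq N).ennreal_ofReal (ae_of_all _ fun _ => ENNReal.ofReal_lt_top)]
  simp only [ENNReal.toReal_ofReal (vandermondeSq_nonneg _ _), Complex.real_smul]

theorem measurable_linearStatistic (N : ℕ) {f : ℂ → ℝ} (hf : Measurable f) :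
    Measurable (linearStatistic N f) := by
  unfold linearStatistic
  fun_prop

variable (N : ℕ) [NeZero N]

theorem integral_vandermondeSq_mul_prod {h : ℝ → ℂ} {C : ℝ} (hm : Measurable h)
    (hC : ∀ x, ‖h x‖ ≤ C) :
    ∫ z : Fin N → ℂ, (vandermondeSq N z : ℂ) * ∏ k, h (‖z k‖ ^ 2)
      ∂(Measure.pi fun _ => ginibreWeight N) =
      N.factorial * ∏ k : Fin N, (Real.pi * (k : ℕ).factorial / (N : ℂ) ^ ((k : ℕ) + 1)) *
        ∫ x, h x ∂gammaMeasure ((k : ℕ) + 1) N := by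
  simp only [ofReal_vandermondeSq_mul_prod]
  rw [integral_det_mul_det (φ := fun (i : Fin N) z => z ^ (i : ℕ))
    (ψ := fun (i : Fin N) z => starRingEnd ℂ z ^ (i : ℕ) * h (‖z‖ ^ 2))
    fun i j => integrable_pow_mul_conj_pow_mul_radial N i j hm hC, Fintype.card_fin,
    ← Matrix.det_diagonal]
  congr 2 with i j
  rcases eq_or_ne i j with rfl | hij
  · rw [Matrix.of_apply, Matrix.diagonal_apply_eq, ← integral_norm_pow_mul_ginibreWeight]
    simp only [← mul_assoc, ← mul_pow, Complex.mul_conj']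
  · rw [Matrix.of_apply, Matrix.diagonal_apply_ne _ hij,
      integral_pow_mul_conj_pow_mul_radial_of_ne N (Fin.val_injective.ne hij)]

theorem ginibreUnnormalized_real_univ :
    ((ginibreUnnormalized N).real Set.univ : ℂ) =
      N.factorial * ∏ k : Fin N, (Real.pi * (k : ℕ).factorial / (N : ℂ) ^ ((k : ℕ) + 1)) := by
  have h_one := integral_ginibreUnnormalized N fun _ => 1
  have h_const := integral_vandermondeSq_mul_prod N (h := fun _ => 1) measurable_const
    (C := 1) fun _ => norm_one.le
  simp only [Finset.prod_const_one] at h_const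
  rw [h_const] at h_one
  simpa using h_one

theorem ginibreUnnormalized_real_univ_ne_zero : (ginibreUnnormalized N).real Set.univ ≠ 0 := by
  rw [← Complex.ofReal_ne_zero, ginibreUnnormalized_real_univ]
  have h_N : (N : ℂ) ≠ 0 := NeZero.ne _
  have h_pi : (Real.pi : ℂ) ≠ 0 := Complex.ofReal_ne_zero.mpr Real.pi_ne_zero
  simp [Finset.prod_ne_zero_iff, Nat.factorial_ne_zero, h_N, h_pi]

instance isProbabilityMeasure_ginibreLaw : IsProbabilityMeasure (ginibreLaw N) := by
  obtain ⟨h_zero, h_top⟩ := ENNReal.toReal_ne_zero.mp (ginibreUnnormalized_real_univ_ne_zero N)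
  exact ⟨ENNReal.inv_mul_cancel h_zero h_top⟩

theorem integral_prod_ginibreLaw {h : ℝ → ℂ} {C : ℝ} (hm : Measurable h)
    (hC : ∀ x, ‖h x‖ ≤ C) :
    ∫ z, ∏ k, h (‖z k‖ ^ 2) ∂ginibreLaw N =
      ∏ k : Fin N, ∫ x, h x ∂gammaMeasure ((k : ℕ) + 1) N := by
  have h_mass := Complex.ofReal_ne_zero.mpr (ginibreUnnormalized_real_univ_ne_zero N)
  rw [ginibreLaw, integral_smul_measure, integral_ginibreUnnormalized,
    integral_vandermondeSq_mul_prod N hm hC, Finset.prod_mul_distrib, ← mul_assoc,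
    ← ginibreUnnormalized_real_univ, ENNReal.toReal_inv, Complex.real_smul, Complex.ofReal_inv,
    ← mul_assoc, measureReal_def]
  rw [measureReal_def] at h_mass
  rw [inv_mul_cancel₀ h_mass, one_mul]

theorem identDistrib_linearStatistic_norm_sq {h : ℝ → ℝ} (hm : Measurable h) :
    IdentDistrib (linearStatistic N fun z => h (‖z‖ ^ 2))
      (fun x : Fin N → ℝ => ∑ k, h (x k))
      (ginibreLaw N) (Measure.pi fun k : Fin N => gammaMeasure ((k : ℕ) + 1) N) := by
  have h_left : Measurable (linearStatistic N fun z => h (‖z‖ ^ 2)) :=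
    measurable_linearStatistic N (by fun_prop)
  have h_prob (k : Fin N) :
      IsProbabilityMeasure ((gammaMeasure ((k : ℕ) + 1) N).map h) :=
    Measure.isProbabilityMeasure_map hm.aemeasurable
  have h_sum : (Measure.pi fun k : Fin N => gammaMeasure ((k : ℕ) + 1) N).map
      (fun x => ∑ k, h (x k)) =
      (Measure.pi fun k : Fin N => (gammaMeasure ((k : ℕ) + 1) N).map h).map
        fun y => ∑ k, y k := by
    rw [← Measure.pi_map_pi fun _ => hm.aemeasurable, Measure.map_map (by fun_prop) (by fun_prop)]
    rfl
  refine ⟨h_left.aemeasurable, Measurable.aemeasurable (by fun_prop), ?_⟩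
  have := Measure.isProbabilityMeasure_map (μ := ginibreLaw N) h_left.aemeasurable
  refine h_sum ▸ Measure.ext_of_charFun (funext fun t => ?_)
  have h_exp : Continuous fun x : ℝ => Complex.exp (t * x * Complex.I) := by fun_prop
  rw [charFun_map_sum_pi_eq_prod, Finset.prod_apply, charFun_apply_real,
    integral_map h_left.aemeasurable h_exp.aestronglyMeasurable]
  simp only [charFun_apply_real, integral_map hm.aemeasurable h_exp.aestronglyMeasurable,
    linearStatistic, Complex.ofReal_sum, Finset.mul_sum, Finset.sum_mul, Complex.exp_sum]
  refine integral_prod_ginibreLaw N (h := fun x => Complex.exp (t * h x * Complex.I)) (C := 1)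
    (by fun_prop) fun x => ?_
  rw [← Complex.ofReal_mul, Complex.norm_exp_ofReal_mul_I]

theorem variance_linearStatistic_norm_sq {h : ℝ → ℝ} {C : ℝ} (hm : Measurable h)
    (hC : ∀ x, ‖h x‖ ≤ C) :
    variance (linearStatistic N fun z => h (‖z‖ ^ 2)) (ginibreLaw N) =
      ∑ k : Fin N, variance h (gammaMeasure ((k : ℕ) + 1) N) := by
  rw [(identDistrib_linearStatistic_norm_sq N hm).variance_eq,
    ← variance_sum_pi fun k => MemLp.of_bound hm.aestronglyMeasurable C (ae_of_all _ hC)]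
  congr 1 with x
  simp

theorem modulusVar_eq_sum {a b : ℝ} (ha : 0 ≤ a) (hab : a ≤ b) :
    modulusVar N a b = ∑ k ∈ Finset.range N,
      (poissonCdf k (N * a ^ 2) - poissonCdf k (N * b ^ 2)) *
        (1 - (poissonCdf k (N * a ^ 2) - poissonCdf k (N * b ^ 2))) := by
  have h_count : modulusCount N a b =
      linearStatistic N fun z => (Set.Icc (a ^ 2) (b ^ 2)).indicator 1 (‖z‖ ^ 2) := by
    refine congrArg (linearStatistic N) (funext fun z => ?_)
    simp only [Set.indicator_apply, Set.mem_ofPred_eq, Set.mem_Icc, Pi.one_apply,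
      sq_le_sq₀ ha (norm_nonneg z), sq_le_sq₀ (norm_nonneg z) (ha.trans hab)]
  rw [modulusVar, h_count, variance_linearStatistic_norm_sq N (C := 1)
    (measurable_one.indicator measurableSet_Icc)
    fun x => (norm_indicator_le_norm_self _ x).trans norm_one.le, Finset.sum_range]
  refine Finset.sum_congr rfl fun k _ => ?_
  rw [variance_indicator_one _ measurableSet_Icc, gammaMeasure_real_Icc k N.cast_nonneg
    (sq_nonneg a) (pow_le_pow_left₀ ha hab 2)]

end Kostlan

section EnergyDistance

/-- The mean distance `E |U - V|` of independent variables `U ∼ P` and `V ∼ Q`. -/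
noncomputable def meanAbsDiff (P Q : Measure ℕ) : ℝ :=
  ∫ p : ℕ × ℕ, |(p.1 : ℝ) - p.2| ∂(P.prod Q)

theorem tsum_indicator_Iic_prod_Ioi (u v : ℕ) :
    ∑' k : ℕ, (Set.Iic k ×ˢ Set.Ioi k : Set (ℕ × ℕ)).indicator (1 : ℕ × ℕ → ENNReal) (u, v) =
      ENNReal.ofReal (max ((v : ℝ) - u) 0) := by
  have h_ite (k : ℕ) : (Set.Iic k ×ˢ Set.Ioi k : Set (ℕ × ℕ)).indicator (1 : ℕ × ℕ → ENNReal)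
      (u, v) = if k ∈ Finset.Ico u v then 1 else 0 := by
    simp [Set.indicator]
  rw [tsum_congr h_ite, tsum_eq_sum (s := Finset.Ico u v) fun k hk => if_neg hk]
  simp only [Finset.sum_ite_mem, Finset.inter_self, Finset.sum_const, Nat.card_Ico, nsmul_eq_mul,
    mul_one]
  rcases le_total u v with huv | hvu
  · rw [max_eq_left (sub_nonneg.mpr (Nat.cast_le.mpr huv)), ← Nat.cast_sub huv,
      ENNReal.ofReal_natCast]
  · rw [max_eq_right (sub_nonpos.mpr (Nat.cast_le.mpr hvu)), Nat.sub_eq_zero_of_le hvu,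
      Nat.cast_zero, ENNReal.ofReal_zero]

theorem hasSum_measureReal_Iic_mul_Ioi (P : Measure ℕ) [IsProbabilityMeasure P] {Q : Measure ℕ}
    (hQ : Integrable (fun n : ℕ => (n : ℝ)) Q) :
    HasSum (fun k : ℕ => P.real (Set.Iic k) * Q.real (Set.Ioi k))
      (∫ p, max ((p.2 : ℝ) - p.1) 0 ∂(P.prod Q)) := by
  have h_int : Integrable (fun p : ℕ × ℕ => max ((p.2 : ℝ) - p.1) 0) (P.prod Q) := by
    refine (hQ.comp_snd P).mono' .of_discrete (ae_of_all _ fun p => ?_)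
    rw [Real.norm_of_nonneg (le_max_right _ _)]
    exact max_le (by simp) (by simp)
  have h_tsum : ∑' k : ℕ, P (Set.Iic k) * Q (Set.Ioi k) =
      ∫⁻ p, ENNReal.ofReal (max ((p.2 : ℝ) - p.1) 0) ∂(P.prod Q) := by
    simp only [← tsum_indicator_Iic_prod_Ioi]
    rw [lintegral_tsum fun k => .of_discrete]
    refine tsum_congr fun k => ?_
    rw [← Measure.prod_prod, lintegral_indicator_one (.of_discrete)]
  have h_ne_top : ∑' k : ℕ, P (Set.Iic k) * Q (Set.Ioi k) ≠ ⊤ :=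
    h_tsum ▸ h_int.lintegral_lt_top.ne
  have h_nonneg : 0 ≤ᵐ[P.prod Q] fun p : ℕ × ℕ => max ((p.2 : ℝ) - p.1) 0 :=
    ae_of_all _ fun p => le_max_right _ _
  have h_sum := ENNReal.hasSum_toReal h_ne_top
  rw [← ENNReal.tsum_toReal_eq fun k => ENNReal.ne_top_of_tsum_ne_top h_ne_top k, h_tsum,
    ← integral_eq_lintegral_of_nonneg_ae h_nonneg h_int.aestronglyMeasurable] at h_sum
  simpa only [ENNReal.toReal_mul, measureReal_def] using h_sum

theorem hasSum_measureReal_Ioi_add (N : ℕ) {Q : Measure ℕ}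
    (hQ : Integrable (fun n : ℕ => (n : ℝ)) Q) :
    HasSum (fun k : ℕ => Q.real (Set.Ioi (k + N))) (∫ n : ℕ, max ((n : ℝ) - N) 0 ∂Q) := by
  have h_sum := hasSum_measureReal_Iic_mul_Ioi (Measure.dirac N) hQ
  rw [Measure.dirac_prod, integral_map .of_discrete .of_discrete, ← hasSum_nat_add_iff' N,
    Finset.sum_eq_zero, sub_zero] at h_sum
  · refine h_sum.congr_fun fun k => ?_
    simp [Measure.real]
  · intro k hk
    simp [Measure.real, Finset.mem_range.mp hk]

variable {P Q : Measure ℕ} [IsProbabilityMeasure P] [IsProbabilityMeasure Q]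

theorem integrable_sub_prod (hP : Integrable (fun n : ℕ => (n : ℝ)) P)
    (hQ : Integrable (fun n : ℕ => (n : ℝ)) Q) :
    Integrable (fun p : ℕ × ℕ => (p.1 : ℝ) - p.2) (P.prod Q) :=
  (hP.comp_fst Q).sub (hQ.comp_snd P)

theorem integral_max_sub_prod (hP : Integrable (fun n : ℕ => (n : ℝ)) P)
    (hQ : Integrable (fun n : ℕ => (n : ℝ)) Q) :
    ∫ p, max ((p.2 : ℝ) - p.1) 0 ∂(P.prod Q) =
      (meanAbsDiff P Q + ∫ n, (n : ℝ) ∂Q - ∫ n, (n : ℝ) ∂P) / 2 := by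
  have h_max (p : ℕ × ℕ) :
      max ((p.2 : ℝ) - p.1) 0 = (|(p.1 : ℝ) - p.2| - ((p.1 : ℝ) - p.2)) / 2 := by
    rcases le_total (p.1 : ℝ) p.2 with h_le | h_ge
    · rw [max_eq_left (sub_nonneg.mpr h_le), abs_of_nonpos (sub_nonpos.mpr h_le)]
      ring
    · rw [max_eq_right (sub_nonpos.mpr h_ge), abs_of_nonneg (sub_nonneg.mpr h_ge)]
      ring
  have h_sub := integrable_sub_prod hP hQ
  simp only [h_max]
  rw [integral_div, integral_sub h_sub.abs h_sub, integral_sub (hP.comp_fst Q) (hQ.comp_snd P),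
    integral_fun_fst, integral_fun_snd, probReal_univ, probReal_univ, one_smul, one_smul,
    meanAbsDiff]
  ring

theorem measureReal_Ioi_eq_one_sub (k : ℕ) : Q.real (Set.Ioi k) = 1 - Q.real (Set.Iic k) := by
  rw [← Set.compl_Iic, probReal_compl_eq_one_sub .of_discrete]

theorem hasSum_cdf_sub_mul_one_sub (hP : Integrable (fun n : ℕ => (n : ℝ)) P)
    (hQ : Integrable (fun n : ℕ => (n : ℝ)) Q) :
    HasSum (fun k : ℕ => (P.real (Set.Iic k) - Q.real (Set.Iic k)) *
        (1 - (P.real (Set.Iic k) - Q.real (Set.Iic k))))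
      (meanAbsDiff P P / 2 + meanAbsDiff Q Q / 2 - meanAbsDiff Q P +
        ∫ n, (n : ℝ) ∂Q - ∫ n, (n : ℝ) ∂P) := by
  have h_sum := ((hasSum_measureReal_Iic_mul_Ioi P hP).add
    (hasSum_measureReal_Iic_mul_Ioi Q hQ)).sub ((hasSum_measureReal_Iic_mul_Ioi Q hP).mul_left 2)
  rw [integral_max_sub_prod hP hP, integral_max_sub_prod hQ hQ, integral_max_sub_prod hQ hP]
    at h_sum
  simp only [measureReal_Ioi_eq_one_sub] at h_sum
  have h_value : meanAbsDiff P P / 2 + meanAbsDiff Q Q / 2 - meanAbsDiff Q P +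
      ∫ n, (n : ℝ) ∂Q - ∫ n, (n : ℝ) ∂P =
        (meanAbsDiff P P + ∫ n, (n : ℝ) ∂P - ∫ n, (n : ℝ) ∂P) / 2 +
          (meanAbsDiff Q Q + ∫ n, (n : ℝ) ∂Q - ∫ n, (n : ℝ) ∂Q) / 2 -
          2 * ((meanAbsDiff Q P + ∫ n, (n : ℝ) ∂P - ∫ n, (n : ℝ) ∂Q) / 2) := by
    ring
  rw [h_value]
  exact h_sum.congr_fun fun k => by ring

theorem integral_max_sub_le_variance_div {Ω : Type*} [MeasurableSpace Ω] {μ : Measure Ω}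
    [IsProbabilityMeasure μ] {X : Ω → ℝ} (hX : MemLp X 2 μ) {c : ℝ} (hc : μ[X] < c) :
    ∫ ω, max (X ω - c) 0 ∂μ ≤ variance X μ / (4 * (c - μ[X])) := by
  have h_pos : 0 < c - μ[X] := sub_pos.mpr hc
  rw [variance_eq_integral hX.aemeasurable, ← integral_div]
  refine integral_mono_of_nonneg (ae_of_all _ fun ω => le_max_right _ _)
    ((hX.sub (memLp_const _)).integrable_sq.div_const _) (ae_of_all _ fun ω => ?_)
  refine max_le ((le_div_iff₀ (mul_pos four_pos h_pos)).mpr ?_)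
    (div_nonneg (sq_nonneg _) (mul_pos four_pos h_pos).le)
  nlinarith [sq_nonneg (X ω - μ[X] - 2 * (c - μ[X]))]

theorem abs_sum_cdf_sub_mul_one_sub_sub_le (hP : Integrable (fun n : ℕ => (n : ℝ)) P)
    (hQ : MemLp (fun n : ℕ => (n : ℝ)) 2 Q)
    (h_le : ∀ k, Q.real (Set.Iic k) ≤ P.real (Set.Iic k)) {N : ℕ} (hN : ∫ n, (n : ℝ) ∂Q < N) :
    |∑ k ∈ Finset.range N, (P.real (Set.Iic k) - Q.real (Set.Iic k)) *
        (1 - (P.real (Set.Iic k) - Q.real (Set.Iic k))) -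
      (meanAbsDiff P P / 2 + meanAbsDiff Q Q / 2 - meanAbsDiff Q P +
        ∫ n, (n : ℝ) ∂Q - ∫ n, (n : ℝ) ∂P)| ≤
      variance (fun n : ℕ => (n : ℝ)) Q / (4 * (N - ∫ n, (n : ℝ) ∂Q)) := by
  have hQ₁ : Integrable (fun n : ℕ => (n : ℝ)) Q := hQ.integrable one_le_two
  have h_tail := (hasSum_nat_add_iff' N).mpr (hasSum_cdf_sub_mul_one_sub hP hQ₁)
  have h_range (k : ℕ) : P.real (Set.Iic k) - Q.real (Set.Iic k) ∈ Set.Icc 0 1 :=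
    ⟨sub_nonneg.mpr (h_le k), by
      linarith [measureReal_le_one (μ := P) (s := Set.Iic k),
        measureReal_nonneg (μ := Q) (s := Set.Iic k)]⟩
  rw [abs_sub_comm, abs_of_nonneg (h_tail.nonneg fun k =>
    mul_nonneg (h_range _).1 (sub_nonneg.mpr (h_range _).2))]
  refine (hasSum_le (fun k => ?_) h_tail (hasSum_measureReal_Ioi_add N hQ₁)).trans
    (integral_max_sub_le_variance_div hQ hN)
  calc _ ≤ P.real (Set.Iic (k + N)) - Q.real (Set.Iic (k + N)) :=
        mul_le_of_le_one_right (h_range _).1 (sub_le_self _ (h_range _).1)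
    _ ≤ Q.real (Set.Ioi (k + N)) := by
        rw [measureReal_Ioi_eq_one_sub]
        exact sub_le_sub_right measureReal_le_one _

end EnergyDistance

section Poisson

theorem hasSum_descFactorial_poisson (r : NNReal) (k : ℕ) :
    HasSum (fun n : ℕ => Real.exp (-r) * r ^ n / n.factorial * (n.descFactorial k : ℝ))
      ((r : ℝ) ^ k) := by
  rw [← hasSum_nat_add_iff' k, Finset.sum_eq_zero fun i hi => by
    rw [Nat.descFactorial_eq_zero_iff_lt.mpr (Finset.mem_range.mp hi), Nat.cast_zero, mul_zero],
    sub_zero]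
  have h_sum := (hasSum_one_poissonMeasure r).mul_left ((r : ℝ) ^ k)
  rw [mul_one] at h_sum
  refine h_sum.congr_fun fun n => ?_
  have h_factorial : ((n + k).factorial : ℝ) = n.factorial * ((n + k).descFactorial k : ℝ) := by
    have h_nat := Nat.factorial_mul_descFactorial (Nat.le_add_left k n)
    rw [Nat.add_sub_cancel] at h_nat
    exact_mod_cast h_nat.symm
  have h_desc : ((n + k).descFactorial k : ℝ) ≠ 0 := by
    rw [Nat.cast_ne_zero, Ne, Nat.descFactorial_eq_zero_iff_lt]
    lia
  rw [h_factorial]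
  field_simp
  ring

variable (r : NNReal)

theorem integrable_descFactorial_poisson (k : ℕ) :
    Integrable (fun n : ℕ => (n.descFactorial k : ℝ)) (poissonMeasure r) := by
  rw [integrable_poissonMeasure_iff]
  simpa using (hasSum_descFactorial_poisson r k).summable

theorem integral_descFactorial_poisson (k : ℕ) :
    ∫ n, (n.descFactorial k : ℝ) ∂poissonMeasure r = (r : ℝ) ^ k := by
  rw [integral_poissonMeasure]
  simpa using (hasSum_descFactorial_poisson r k).tsum_eq

theorem integrable_cast_poisson : Integrable (fun n : ℕ => (n : ℝ)) (poissonMeasure r) := by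
  simpa using integrable_descFactorial_poisson r 1

theorem integral_cast_poisson : ∫ n, (n : ℝ) ∂poissonMeasure r = r := by
  simpa using integral_descFactorial_poisson r 1

theorem cast_sq_eq_descFactorial_add (n : ℕ) :
    (n : ℝ) ^ 2 = (n.descFactorial 2 : ℝ) + n.descFactorial 1 := by
  rw [Nat.cast_descFactorial_two, Nat.descFactorial_one]
  ring

theorem memLp_two_cast_poisson : MemLp (fun n : ℕ => (n : ℝ)) 2 (poissonMeasure r) := by
  rw [memLp_two_iff_integrable_sq .of_discrete]
  simp only [cast_sq_eq_descFactorial_add]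
  exact (integrable_descFactorial_poisson r 2).add (integrable_descFactorial_poisson r 1)

theorem variance_cast_poisson : variance (fun n : ℕ => (n : ℝ)) (poissonMeasure r) = r := by
  rw [variance_eq_sub (memLp_two_cast_poisson r)]
  simp only [Pi.pow_apply, cast_sq_eq_descFactorial_add]
  rw [integral_add (integrable_descFactorial_poisson r 2) (integrable_descFactorial_poisson r 1),
    integral_descFactorial_poisson, integral_descFactorial_poisson, integral_cast_poisson]
  ring

theorem poissonMeasure_real_Iic (k : ℕ) :
    (poissonMeasure r).real (Set.Iic k) = poissonCdf k r := by
  have h_coe : (Set.Iic k : Set ℕ) = ↑(Finset.range (k + 1)) := by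
    ext i
    simp
  rw [h_coe, ← sum_measureReal_singleton, poissonCdf, Finset.mul_sum]
  simp only [poissonMeasure_real_singleton, mul_div_assoc]

theorem antitoneOn_poissonCdf (k : ℕ) : AntitoneOn (poissonCdf k) (Set.Ici 0) := by
  intro x hx y _ hxy
  have h_Icc := gammaMeasure_real_Icc k zero_le_one hx hxy
  rw [one_mul, one_mul] at h_Icc
  exact sub_nonneg.mp (h_Icc ▸ measureReal_nonneg)

theorem abs_sum_poissonCdf_sub_le {x y : NNReal} (hxy : x ≤ y) {N : ℕ} (hy : (y : ℝ) < N) :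
    |∑ k ∈ Finset.range N, (poissonCdf k x - poissonCdf k y) *
        (1 - (poissonCdf k x - poissonCdf k y)) -
      (meanAbsDiff (poissonMeasure x) (poissonMeasure x) / 2 +
        meanAbsDiff (poissonMeasure y) (poissonMeasure y) / 2 -
        meanAbsDiff (poissonMeasure y) (poissonMeasure x) + y - x)| ≤ y / (4 * (N - y)) := by
  have h := abs_sum_cdf_sub_mul_one_sub_sub_le (N := N) (integrable_cast_poisson x)
    (memLp_two_cast_poisson y)
    (fun k => by
      rw [poissonMeasure_real_Iic, poissonMeasure_real_Iic]
      exact antitoneOn_poissonCdf k x.2 y.2 hxy)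
    (by rwa [integral_cast_poisson])
  simpa only [poissonMeasure_real_Iic, integral_cast_poisson, variance_cast_poisson] using h

end Poisson

section AbsoluteMoment

theorem one_sub_cos_div_sq_nonneg (t : ℝ) : 0 ≤ (1 - Real.cos t) / t ^ 2 :=
  div_nonneg (sub_nonneg.mpr (Real.cos_le_one t)) (sq_nonneg t)

theorem one_sub_cos_div_sq_le (t : ℝ) : (1 - Real.cos t) / t ^ 2 ≤ 4 * (1 + t ^ 2)⁻¹ := by
  rcases eq_or_ne t 0 with rfl | ht
  · simp
  rw [div_le_iff₀ (by positivity), mul_assoc, inv_mul_eq_div, mul_div_assoc',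
    le_div_iff₀ (by positivity)]
  nlinarith [sq_nonneg t, Real.one_sub_sq_div_two_le_cos (x := t), Real.neg_one_le_cos t]

theorem integrable_one_sub_cos_div_sq : Integrable fun t : ℝ => (1 - Real.cos t) / t ^ 2 := by
  refine (integrable_inv_one_add_sq.const_mul 4).mono'
    (Measurable.aestronglyMeasurable (by fun_prop)) (ae_of_all _ fun t => ?_)
  rw [Real.norm_of_nonneg (one_sub_cos_div_sq_nonneg t)]
  exact one_sub_cos_div_sq_le t

/-- The constant `c = ∫ (1 - cos t) / t² dt` in the representation
`c |s| = ∫ (1 - cos (s t)) / t² dt` of the absolute value. -/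
noncomputable def absFourierConst : ℝ := ∫ t : ℝ, (1 - Real.cos t) / t ^ 2

theorem absFourierConst_pos : 0 < absFourierConst := by
  rw [absFourierConst, integral_pos_iff_support_of_nonneg one_sub_cos_div_sq_nonneg
    integrable_one_sub_cos_div_sq]
  refine lt_of_lt_of_le ?_ (measure_mono (s := Set.Ioo 0 1) fun t ht => ?_)
  · rw [Real.volume_Ioo]
    simp
  · have h_cos : Real.cos t < 1 := by
      simpa using Real.cos_lt_cos_of_nonneg_of_le_pi le_rfl
        (ht.2.le.trans (one_le_two.trans Real.two_le_pi)) ht.1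
    exact (div_pos (sub_pos.mpr h_cos) (pow_pos ht.1 2)).ne'

theorem one_sub_cos_mul_div_sq (s t : ℝ) :
    (1 - Real.cos (s * t)) / t ^ 2 = s ^ 2 * ((1 - Real.cos (s * t)) / (s * t) ^ 2) := by
  rcases eq_or_ne s 0 with rfl | hs
  · simp
  rcases eq_or_ne t 0 with rfl | ht
  · simp
  field_simp

theorem integrable_one_sub_cos_mul_div_sq (s : ℝ) :
    Integrable fun t : ℝ => (1 - Real.cos (s * t)) / t ^ 2 := by
  rcases eq_or_ne s 0 with rfl | hs
  · simp
  simp only [one_sub_cos_mul_div_sq s]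
  exact (integrable_one_sub_cos_div_sq.comp_mul_left' hs).const_mul _

theorem integral_one_sub_cos_mul_div_sq (s : ℝ) :
    ∫ t : ℝ, (1 - Real.cos (s * t)) / t ^ 2 = absFourierConst * |s| := by
  simp only [one_sub_cos_mul_div_sq s]
  rw [integral_const_mul,
    Measure.integral_comp_mul_left (fun t : ℝ => (1 - Real.cos t) / t ^ 2) s, ← absFourierConst,
    smul_eq_mul, abs_inv, ← mul_assoc, ← sq_abs, pow_two, mul_self_mul_inv, mul_comm]

theorem integrable_prod_one_sub_cos_mul_div_sq {ρ : Measure ℝ}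
    (hρ : Integrable id ρ) :
    Integrable (fun p : ℝ × ℝ => (1 - Real.cos (p.1 * p.2)) / p.2 ^ 2) (ρ.prod volume) := by
  have h_norm (s t : ℝ) : ‖(1 - Real.cos (s * t)) / t ^ 2‖ = (1 - Real.cos (s * t)) / t ^ 2 :=
    Real.norm_of_nonneg (div_nonneg (sub_nonneg.mpr (Real.cos_le_one _)) (sq_nonneg t))
  rw [integrable_prod_iff (Measurable.aestronglyMeasurable (by fun_prop))]
  refine ⟨ae_of_all _ integrable_one_sub_cos_mul_div_sq, ?_⟩
  simp only [h_norm, integral_one_sub_cos_mul_div_sq]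
  exact hρ.abs.const_mul _

variable (ρ : Measure ℝ) [IsProbabilityMeasure ρ]

theorem integrable_cos_mul (t : ℝ) : Integrable (fun s => Real.cos (s * t)) ρ :=
  .of_bound (Measurable.aestronglyMeasurable (by fun_prop)) 1
    (ae_of_all _ fun _ => Real.abs_cos_le_one _)

theorem integral_cos_mul_eq_re_charFun (t : ℝ) :
    ∫ s, Real.cos (s * t) ∂ρ = (charFun ρ t).re := by
  have h_re (s : ℝ) : (Complex.exp (t * s * Complex.I)).re = Real.cos (s * t) := by
    rw [← Complex.ofReal_mul, Complex.exp_ofReal_mul_I_re, mul_comm]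
  have h_int : Integrable (fun s : ℝ => Complex.exp (t * s * Complex.I)) ρ := by
    refine .of_bound (Measurable.aestronglyMeasurable (by fun_prop)) 1 (ae_of_all _ fun s => ?_)
    rw [← Complex.ofReal_mul, Complex.norm_exp_ofReal_mul_I]
  rw [charFun_apply_real, ← RCLike.re_eq_complex_re, ← integral_re h_int]
  simp only [RCLike.re_eq_complex_re, h_re]

theorem integral_one_sub_cos_mul_div_sq_eq_re_charFun (t : ℝ) :
    ∫ s, (1 - Real.cos (s * t)) / t ^ 2 ∂ρ = (1 - (charFun ρ t).re) / t ^ 2 := by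
  rw [integral_div, integral_sub (integrable_const _) (integrable_cos_mul ρ t),
    integral_cos_mul_eq_re_charFun, integral_const, probReal_univ, one_smul]

variable {ρ}

theorem integrable_one_sub_re_charFun_div_sq (hρ : Integrable id ρ) :
    Integrable fun t : ℝ => (1 - (charFun ρ t).re) / t ^ 2 := by
  simpa only [integral_one_sub_cos_mul_div_sq_eq_re_charFun] using
    (integrable_prod_one_sub_cos_mul_div_sq hρ).integral_prod_right

theorem absFourierConst_mul_integral_abs (hρ : Integrable id ρ) :
    absFourierConst * ∫ s, |s| ∂ρ = ∫ t : ℝ, (1 - (charFun ρ t).re) / t ^ 2 := by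
  rw [← integral_const_mul]
  simp only [← integral_one_sub_cos_mul_div_sq, ← integral_one_sub_cos_mul_div_sq_eq_re_charFun ρ]
  exact integral_integral_swap (integrable_prod_one_sub_cos_mul_div_sq hρ)

theorem absFourierConst_mul_abs_integral_abs_sub_le {σ : Measure ℝ} [IsProbabilityMeasure σ]
    (hρ : Integrable id ρ) (hσ : Integrable id σ) {g : ℝ → ℝ} (hg : Integrable g)
    (h_le : ∀ t, |(charFun σ t).re - (charFun ρ t).re| / t ^ 2 ≤ g t) :
    absFourierConst * |∫ s, |s| ∂ρ - ∫ s, |s| ∂σ| ≤ ∫ t, g t := by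
  rw [← abs_of_pos absFourierConst_pos, ← abs_mul, mul_sub,
    absFourierConst_mul_integral_abs hρ, absFourierConst_mul_integral_abs hσ,
    ← integral_sub (integrable_one_sub_re_charFun_div_sq hρ)
      (integrable_one_sub_re_charFun_div_sq hσ), ← Real.norm_eq_abs]
  refine norm_integral_le_of_norm_le hg (ae_of_all _ fun t => ?_)
  rw [← sub_div, norm_div, Real.norm_eq_abs, Real.norm_of_nonneg (sq_nonneg t),
    sub_sub_sub_cancel_left]
  exact h_le t

end AbsoluteMoment

section Skellam

/-- The Skellam distribution: the law of the difference of independent Poisson variables of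
means `x` and `y`. -/
noncomputable def skellamMeasure (x y : NNReal) : Measure ℝ :=
  ((poissonMeasure x).prod (poissonMeasure y)).map fun p => (p.1 : ℝ) - p.2

variable (x y : NNReal)

instance isProbabilityMeasure_skellamMeasure : IsProbabilityMeasure (skellamMeasure x y) :=
  Measure.isProbabilityMeasure_map .of_discrete

theorem integrable_id_skellamMeasure : Integrable id (skellamMeasure x y) := by
  rw [skellamMeasure, integrable_map_measure (by fun_prop) .of_discrete]
  exact integrable_sub_prod (integrable_cast_poisson x) (integrable_cast_poisson y)

theorem integral_abs_skellamMeasure :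
    ∫ s, |s| ∂skellamMeasure x y = meanAbsDiff (poissonMeasure x) (poissonMeasure y) := by
  rw [skellamMeasure, integral_map .of_discrete (by fun_prop), meanAbsDiff]

theorem charFun_skellamMeasure (t : ℝ) :
    charFun (skellamMeasure x y) t =
      Complex.exp (x * (Complex.exp (t * Complex.I) - 1)) *
        Complex.exp (y * (Complex.exp ((-t : ℝ) * Complex.I) - 1)) := by
  rw [← charFun_map_cast_poissonMeasure, ← charFun_map_cast_poissonMeasure, charFun_apply_real,
    charFun_apply_real, charFun_apply_real, skellamMeasure,
    integral_map .of_discrete (by fun_prop), integral_map .of_discrete (by fun_prop),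
    integral_map .of_discrete (by fun_prop), ← integral_prod_mul]
  congr 1 with p
  rw [← Complex.exp_add]
  congr 1
  push_cast
  ring

theorem re_exp_add_mul_I (u w : ℝ) :
    (Complex.exp (u + w * Complex.I)).re = Real.exp u * Real.cos w := by
  simp [Complex.exp_re]

theorem re_charFun_skellamMeasure (t : ℝ) :
    (charFun (skellamMeasure x y) t).re =
      Real.exp (-((x + y) * (1 - Real.cos t))) * Real.cos ((x - y) * Real.sin t) := by
  rw [charFun_skellamMeasure, ← Complex.exp_add, ← re_exp_add_mul_I, Complex.exp_mul_I,
    Complex.exp_mul_I, ← Complex.ofReal_cos, ← Complex.ofReal_sin, ← Complex.ofReal_cos,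
    ← Complex.ofReal_sin, Real.cos_neg, Real.sin_neg]
  push_cast
  ring_nf

theorem re_charFun_gaussianReal (m : ℝ) (v : NNReal) (t : ℝ) :
    (charFun (gaussianReal m v) t).re = Real.exp (-(v * (t ^ 2 / 2))) * Real.cos (m * t) := by
  rw [charFun_gaussianReal, ← re_exp_add_mul_I]
  push_cast
  ring_nf

theorem abs_exp_neg_sub_exp_neg_le {p q r : ℝ} (hp : r ≤ p) (hq : r ≤ q) :
    |Real.exp (-p) - Real.exp (-q)| ≤ Real.exp (-r) * |p - q| := by
  wlog hpq : p ≤ q generalizing p q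
  · rw [abs_sub_comm, abs_sub_comm p q]
    exact this hq hp (le_of_not_ge hpq)
  rw [abs_of_nonneg (sub_nonneg.mpr (Real.exp_le_exp.mpr (neg_le_neg hpq))),
    abs_of_nonpos (sub_nonpos.mpr hpq)]
  calc Real.exp (-p) - Real.exp (-q) = Real.exp (-p) * (1 - Real.exp (p - q)) := by
        rw [mul_sub, mul_one, ← Real.exp_add, sub_eq_add_neg p, neg_add_cancel_left]
    _ ≤ Real.exp (-p) * -(p - q) := by
        gcongr
        linarith [Real.add_one_le_exp (p - q)]
    _ ≤ Real.exp (-r) * -(p - q) := by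
        gcongr
        linarith

theorem abs_cos_sub_cos_le (u w : ℝ) : |Real.cos u - Real.cos w| ≤ |u - w| := by
  simpa [dist_eq_norm] using Real.lipschitzWith_cos.dist_le_mul u w

theorem abs_exp_neg_mul_cos_sub_le {p q r u w : ℝ} (hp : r ≤ p) (hq : r ≤ q) :
    |Real.exp (-p) * Real.cos u - Real.exp (-q) * Real.cos w| ≤
      Real.exp (-r) * (|p - q| + |u - w|) := by
  calc _ = |(Real.exp (-p) - Real.exp (-q)) * Real.cos u +
          Real.exp (-q) * (Real.cos u - Real.cos w)| := by
        ring_nf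
    _ ≤ |Real.exp (-p) - Real.exp (-q)| * |Real.cos u| +
          Real.exp (-q) * |Real.cos u - Real.cos w| := by
        refine (abs_add_le _ _).trans_eq ?_
        rw [abs_mul, abs_mul, Real.abs_exp]
    _ ≤ Real.exp (-r) * |p - q| * 1 + Real.exp (-r) * |u - w| := by
        refine add_le_add ?_ ?_
        · exact mul_le_mul (abs_exp_neg_sub_exp_neg_le hp hq) (Real.abs_cos_le_one u)
            (abs_nonneg _) (by positivity)
        · exact mul_le_mul (Real.exp_le_exp.mpr (neg_le_neg hq)) (abs_cos_sub_cos_le u w)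
            (abs_nonneg _) (Real.exp_nonneg _)
    _ = _ := by ring

theorem abs_sq_div_two_sub_one_sub_cos_le {t : ℝ} (ht : |t| ≤ 1) :
    |t ^ 2 / 2 - (1 - Real.cos t)| ≤ |t| ^ 3 := by
  have h_pow : |t| ^ 4 ≤ |t| ^ 3 := pow_le_pow_of_le_one (abs_nonneg t) ht (by norm_num)
  calc |t ^ 2 / 2 - (1 - Real.cos t)| = |Real.cos t - (1 - t ^ 2 / 2)| := by ring_nf
    _ ≤ |t| ^ 4 * (5 / 96) := Real.cos_bound ht
    _ ≤ |t| ^ 3 := by linarith [pow_nonneg (abs_nonneg t) 4]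

theorem abs_self_sub_sin_le {t : ℝ} (ht : |t| ≤ 1) : |t - Real.sin t| ≤ |t| ^ 3 := by
  have h_pow : |t| ^ 5 ≤ |t| ^ 3 := pow_le_pow_of_le_one (abs_nonneg t) ht (by norm_num)
  calc |t - Real.sin t| = |t ^ 3 / 6 - (Real.sin t - (t - t ^ 3 / 6))| := by ring_nf
    _ ≤ |t ^ 3 / 6| + |Real.sin t - (t - t ^ 3 / 6)| := abs_sub _ _
    _ ≤ |t| ^ 3 / 6 + |t| ^ 5 / 100 := by
        rw [abs_div, abs_pow, abs_of_pos (by norm_num : (0 : ℝ) < 6)]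
        gcongr
        exact Real.sin_bound ht
    _ ≤ |t| ^ 3 := by linarith [pow_nonneg (abs_nonneg t) 3]

theorem sq_div_four_le_one_sub_cos {t : ℝ} (ht : |t| ≤ 1) : t ^ 2 / 4 ≤ 1 - Real.cos t := by
  have h_pow : |t| ^ 4 ≤ t ^ 2 := by
    rw [← sq_abs]
    exact pow_le_pow_of_le_one (abs_nonneg t) ht (by norm_num)
  linarith [(abs_le.mp (Real.cos_bound ht)).2, sq_nonneg t]

theorem abs_re_charFun_gaussianReal_sub_skellamMeasure_le {t : ℝ} (ht : |t| ≤ 1) :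
    |(charFun (gaussianReal (x - y) (x + y)) t).re - (charFun (skellamMeasure x y) t).re| ≤
      2 * (x + y) * |t| ^ 3 * Real.exp (-((x + y) * (t ^ 2 / 4))) := by
  have h_exp : |((x : ℝ) + y) * (t ^ 2 / 2) - (x + y) * (1 - Real.cos t)| ≤
      (x + y) * |t| ^ 3 := by
    rw [← mul_sub, abs_mul, abs_of_nonneg (by positivity)]
    gcongr
    exact abs_sq_div_two_sub_one_sub_cos_le ht
  have h_cos : |((x : ℝ) - y) * t - (x - y) * Real.sin t| ≤ (x + y) * |t| ^ 3 := by
    rw [← mul_sub, abs_mul]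
    refine mul_le_mul ?_ (abs_self_sub_sin_le ht) (abs_nonneg _) (by positivity)
    exact abs_le.mpr ⟨by linarith [x.2], by linarith [y.2]⟩
  rw [re_charFun_gaussianReal, re_charFun_skellamMeasure, NNReal.coe_add]
  refine (abs_exp_neg_mul_cos_sub_le (r := (x + y) * (t ^ 2 / 4)) ?_ ?_).trans ?_
  · gcongr
    norm_num
  · gcongr
    exact sq_div_four_le_one_sub_cos ht
  · calc _ ≤ Real.exp (-((x + y) * (t ^ 2 / 4))) * ((x + y) * |t| ^ 3 + (x + y) * |t| ^ 3) := by
          gcongr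
      _ = _ := by ring

theorem abs_re_charFun_sub_div_sq_le_of_one_le {ρ σ : Measure ℝ} [IsProbabilityMeasure ρ]
    [IsProbabilityMeasure σ] {t : ℝ} (ht : 1 ≤ |t|) :
    |(charFun ρ t).re - (charFun σ t).re| / t ^ 2 ≤ 4 * (1 + t ^ 2)⁻¹ := by
  have h_sq : 1 ≤ t ^ 2 := one_le_sq_iff_one_le_abs t |>.mpr ht
  have h_two : |(charFun ρ t).re - (charFun σ t).re| ≤ 1 + 1 :=
    (abs_sub _ _).trans (add_le_add ((Complex.abs_re_le_norm _).trans (norm_charFun_le_one t))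
      ((Complex.abs_re_le_norm _).trans (norm_charFun_le_one t)))
  calc |(charFun ρ t).re - (charFun σ t).re| / t ^ 2 ≤ (1 + 1) / t ^ 2 := by gcongr
    _ ≤ 4 * (1 + t ^ 2)⁻¹ := by
        rw [← div_eq_mul_inv, div_le_div_iff₀ (by positivity) (by positivity)]
        linarith

theorem abs_re_charFun_gaussianReal_sub_skellamMeasure_div_sq_le (t : ℝ) :
    |(charFun (gaussianReal (x - y) (x + y)) t).re - (charFun (skellamMeasure x y) t).re| /
      t ^ 2 ≤ 2 * (x + y) * (|t| * Real.exp (-((x + y) / 4) * |t| ^ 2)) +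
        4 * (1 + t ^ 2)⁻¹ := by
  rcases eq_or_ne t 0 with rfl | h_ne
  · simp
  rcases le_total |t| 1 with ht | ht
  · refine le_add_of_le_of_nonneg ?_ (by positivity)
    rw [div_le_iff₀ (by positivity)]
    refine (abs_re_charFun_gaussianReal_sub_skellamMeasure_le x y ht).trans_eq ?_
    rw [← sq_abs t]
    ring_nf
  · exact le_add_of_nonneg_of_le (by positivity) (abs_re_charFun_sub_div_sq_le_of_one_le ht)

theorem integrable_abs_mul_exp_neg_mul_sq {b : ℝ} (hb : 0 < b) :
    Integrable fun t : ℝ => |t| * Real.exp (-b * |t| ^ 2) := by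
  simpa [abs_mul] using (integrable_mul_exp_neg_mul_sq hb).abs

theorem integral_abs_mul_exp_neg_mul_sq {b : ℝ} (hb : 0 < b) :
    ∫ t : ℝ, |t| * Real.exp (-b * |t| ^ 2) = b⁻¹ := by
  have h_Ioi : ∫ t in Set.Ioi (0 : ℝ), t * Real.exp (-b * t ^ 2) = b⁻¹ * (1 / 2) := by
    have h_rpow := integral_rpow_mul_exp_neg_mul_rpow (q := 1) two_pos (by norm_num) hb
    norm_num [Real.rpow_neg_one] at h_rpow ⊢
    exact h_rpow
  rw [integral_comp_abs (f := fun t => t * Real.exp (-b * t ^ 2)), h_Ioi]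
  ring

theorem integrable_id_gaussianReal (m : ℝ) (v : NNReal) : Integrable id (gaussianReal m v) :=
  (memLp_id_gaussianReal 1).integrable le_rfl

variable {x y}

theorem abs_meanAbsDiff_poisson_sub_gaussianReal_le (hxy : 0 < x + y) :
    |meanAbsDiff (poissonMeasure x) (poissonMeasure y) -
        ∫ s, |s| ∂gaussianReal (x - y) (x + y)| ≤ (8 + 4 * Real.pi) / absFourierConst := by
  have h_var : (0 : ℝ) < x + y := mod_cast hxy
  have h_quarter : (0 : ℝ) < (x + y) / 4 := by positivity
  have h_main := (integrable_abs_mul_exp_neg_mul_sq h_quarter).const_mul (2 * (x + y : ℝ))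
  have h_cauchy := integrable_inv_one_add_sq.const_mul 4
  rw [le_div_iff₀' absFourierConst_pos, ← integral_abs_skellamMeasure]
  refine (absFourierConst_mul_abs_integral_abs_sub_le (integrable_id_skellamMeasure x y)
    (integrable_id_gaussianReal _ _) (h_main.add h_cauchy)
    (abs_re_charFun_gaussianReal_sub_skellamMeasure_div_sq_le x y)).trans_eq ?_
  rw [integral_add' h_main h_cauchy, integral_const_mul, integral_const_mul,
    integral_abs_mul_exp_neg_mul_sq h_quarter, integral_univ_inv_one_add_sq]
  field_simp
  ring

end Skellam

section TruncatedGaussian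

theorem abs_add_add_abs_sub_eq {m : ℝ} (hm : 0 ≤ m) (s : ℝ) :
    |s + m| + |s - m| = 2 * (|s| + m - min m |s|) := by
  rcases le_total |s| m with hs | hs
  · obtain ⟨h_lower, h_upper⟩ := abs_le.mp hs
    rw [min_eq_right hs, abs_of_nonneg (neg_le_iff_add_nonneg.mp h_lower),
      abs_of_nonpos (sub_nonpos.mpr h_upper)]
    ring
  · rw [min_eq_left hs, add_sub_cancel_right]
    rcases le_abs'.mp hs with h_neg | h_pos
    · rw [abs_of_nonpos (by linarith), abs_of_nonpos (by linarith), abs_of_nonpos (by linarith)]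
      ring
    · rw [abs_of_nonneg (by linarith), abs_of_nonneg (by linarith), abs_of_nonneg (by linarith)]
      ring

theorem integral_abs_add_of_map_neg {ρ : Measure ℝ} [IsProbabilityMeasure ρ]
    (h_neg : ρ.map (fun s => -s) = ρ) (hρ : Integrable id ρ) {m : ℝ} (hm : 0 ≤ m) :
    ∫ s, |s + m| ∂ρ = ∫ s, |s| ∂ρ + m - ∫ s, min m |s| ∂ρ := by
  have h_add : Integrable (fun s => |s + m|) ρ := (hρ.add (integrable_const m)).abs
  have h_sub : Integrable (fun s => |s - m|) ρ := (hρ.sub (integrable_const m)).abs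
  have h_symm : ∫ s, |s - m| ∂ρ = ∫ s, |s + m| ∂ρ := by
    conv_lhs => rw [← h_neg]
    rw [integral_map (by fun_prop) (by fun_prop)]
    congr 1 with s
    rw [← abs_neg, neg_sub, sub_neg_eq_add, add_comm]
  have h_sum : ∫ s, |s + m| ∂ρ + ∫ s, |s - m| ∂ρ =
      2 * (∫ s, |s| ∂ρ + m - ∫ s, min m |s| ∂ρ) := by
    rw [← integral_add h_add h_sub]
    simp only [abs_add_add_abs_sub_eq hm]
    rw [integral_const_mul, integral_sub, integral_add, integral_const, probReal_univ, one_smul]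
    exacts [hρ.abs, integrable_const m, hρ.abs.add (integrable_const m),
      (integrable_const m).inf hρ.abs]
  linarith

/-- The truncated absolute moment `E min(m, σ |Z|)` of the centred Gaussian variable `σ Z` of
standard deviation `σ ≥ 0`, where `Z` is standard. -/
noncomputable def truncGaussAbs (σ m : ℝ) : ℝ := ∫ z, min m (σ * |z|) ∂gaussianReal 0 1

theorem integral_abs_stdGaussian : ∫ z, |z| ∂gaussianReal 0 1 = √2 / √Real.pi := by
  have h_density (z : ℝ) : gaussianPDFReal 0 1 z • |z| =
      (√(2 * Real.pi))⁻¹ * (|z| * Real.exp (-(1 / 2) * |z| ^ 2)) := by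
    rw [gaussianPDFReal, sq_abs, NNReal.coe_one, sub_zero, smul_eq_mul]
    ring_nf
  rw [integral_gaussianReal_eq_integral_smul one_ne_zero]
  simp only [h_density]
  rw [integral_const_mul, integral_abs_mul_exp_neg_mul_sq one_half_pos,
    Real.sqrt_mul zero_le_two, one_div, inv_inv]
  field_simp
  rw [Real.sq_sqrt zero_le_two]

theorem integral_gaussianReal_zero {f : ℝ → ℝ} (hf : Measurable f) (v : NNReal) :
    ∫ s, f s ∂gaussianReal 0 v = ∫ z, f (√v * z) ∂gaussianReal 0 1 := by
  have h_map : gaussianReal 0 v = (gaussianReal 0 1).map (√(v : ℝ) * ·) := by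
    rw [gaussianReal_map_const_mul, mul_zero, mul_one]
    congr
    ext
    simp
  rw [h_map, integral_map (by fun_prop) hf.aestronglyMeasurable]

theorem integral_abs_gaussianReal_zero (v : NNReal) :
    ∫ s, |s| ∂gaussianReal 0 v = √v * (√2 / √Real.pi) := by
  rw [integral_gaussianReal_zero (by fun_prop), ← integral_abs_stdGaussian, ← integral_const_mul]
  simp only [abs_mul, abs_of_nonneg (Real.sqrt_nonneg _)]

theorem integral_min_abs_gaussianReal_zero (v : NNReal) (m : ℝ) :
    ∫ s, min m |s| ∂gaussianReal 0 v = truncGaussAbs √v m := by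
  rw [integral_gaussianReal_zero (by fun_prop), truncGaussAbs]
  simp only [abs_mul, abs_of_nonneg (Real.sqrt_nonneg _)]

theorem integral_abs_gaussianReal {m : ℝ} (hm : 0 ≤ m) (v : NNReal) :
    ∫ s, |s| ∂gaussianReal m v = √v * (√2 / √Real.pi) + m - truncGaussAbs √v m := by
  have h_neg : (gaussianReal 0 v).map (fun s => -s) = gaussianReal 0 v := by
    rw [gaussianReal_map_neg, neg_zero]
  rw [← integral_abs_gaussianReal_zero, ← integral_min_abs_gaussianReal_zero,
    ← integral_abs_add_of_map_neg h_neg (integrable_id_gaussianReal 0 v) hm,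
    ← integral_map (φ := (· + m)) (f := fun s => |s|) (by fun_prop) (by fun_prop),
    gaussianReal_map_add_const, zero_add]

theorem integrable_mul_abs_stdGaussian (σ : ℝ) :
    Integrable (fun z : ℝ => σ * |z|) (gaussianReal 0 1) :=
  (integrable_id_gaussianReal 0 1).abs.const_mul σ

theorem integrable_min_mul_abs_stdGaussian (σ m : ℝ) :
    Integrable (fun z : ℝ => min m (σ * |z|)) (gaussianReal 0 1) :=
  (integrable_const m).inf (integrable_mul_abs_stdGaussian σ)

theorem truncGaussAbs_nonneg {σ m : ℝ} (hσ : 0 ≤ σ) (hm : 0 ≤ m) : 0 ≤ truncGaussAbs σ m :=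
  integral_nonneg fun z => le_min hm (mul_nonneg hσ (abs_nonneg z))

theorem truncGaussAbs_le_left (σ m : ℝ) : truncGaussAbs σ m ≤ σ * (√2 / √Real.pi) := by
  rw [← integral_abs_stdGaussian, ← integral_const_mul]
  exact integral_mono (integrable_min_mul_abs_stdGaussian σ m) (integrable_mul_abs_stdGaussian σ)
    fun z => min_le_right _ _

theorem truncGaussAbs_le_right (σ m : ℝ) : truncGaussAbs σ m ≤ m := by
  simpa [truncGaussAbs] using integral_mono (integrable_min_mul_abs_stdGaussian σ m)
    (integrable_const m) fun z => min_le_left m (σ * |z|)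

theorem truncGaussAbs_zero_right {σ : ℝ} (hσ : 0 ≤ σ) : truncGaussAbs σ 0 = 0 :=
  le_antisymm (truncGaussAbs_le_right σ 0) (truncGaussAbs_nonneg hσ le_rfl)

theorem mul_truncGaussAbs {k : ℝ} (hk : 0 ≤ k) (σ m : ℝ) :
    k * truncGaussAbs σ m = truncGaussAbs (k * σ) (k * m) := by
  simp only [truncGaussAbs, ← integral_const_mul, mul_min_of_nonneg _ _ hk, mul_assoc]

theorem abs_truncGaussAbs_sub_le (σ τ m n : ℝ) :
    |truncGaussAbs σ m - truncGaussAbs τ n| ≤ |m - n| + |σ - τ| * (√2 / √Real.pi) := by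
  have h_bound : Integrable (fun z : ℝ => |m - n| + |σ - τ| * |z|) (gaussianReal 0 1) :=
    (integrable_const _).add (integrable_mul_abs_stdGaussian _)
  rw [truncGaussAbs, truncGaussAbs, ← integral_sub (integrable_min_mul_abs_stdGaussian σ m)
    (integrable_min_mul_abs_stdGaussian τ n), ← Real.norm_eq_abs]
  refine (norm_integral_le_of_norm_le h_bound (ae_of_all _ fun z => ?_)).trans_eq ?_
  · refine (abs_min_sub_min_le_max _ _ _ _).trans
      ((max_le_add_of_nonneg (abs_nonneg _) (abs_nonneg _)).trans_eq ?_)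
    rw [← sub_mul, abs_mul, abs_abs]
  · rw [integral_add (integrable_const _) (integrable_mul_abs_stdGaussian _), integral_const_mul,
      integral_abs_stdGaussian, integral_const, probReal_univ, one_smul]

theorem integral_sq_stdGaussian : ∫ z, z ^ 2 ∂gaussianReal 0 1 = 1 := by
  have h_var := variance_fun_id_gaussianReal (μ := 0) (v := 1)
  rw [variance_eq_integral (by fun_prop), integral_id_gaussianReal] at h_var
  simpa using h_var

theorem mul_abs_sub_min_le {m : ℝ} (hm : 0 < m) (σ z : ℝ) :
    σ * |z| - min m (σ * |z|) ≤ σ ^ 2 / (4 * m) * z ^ 2 := by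
  rcases min_cases m (σ * |z|) with ⟨h_min, _⟩ | ⟨h_min, _⟩
  · rw [h_min, div_mul_eq_mul_div, le_div_iff₀ (by positivity), ← sq_abs z]
    nlinarith [sq_nonneg (σ * |z| - 2 * m)]
  · rw [h_min, sub_self]
    positivity

theorem sub_truncGaussAbs_le_sq_div {m : ℝ} (hm : 0 < m) (σ : ℝ) :
    σ * (√2 / √Real.pi) - truncGaussAbs σ m ≤ σ ^ 2 / (4 * m) := by
  have h_sq : Integrable (fun z : ℝ => z ^ 2) (gaussianReal 0 1) :=
    (memLp_id_gaussianReal 2).integrable_sq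
  calc σ * (√2 / √Real.pi) - truncGaussAbs σ m
      = ∫ z, (σ * |z| - min m (σ * |z|)) ∂gaussianReal 0 1 := by
        rw [integral_sub (integrable_mul_abs_stdGaussian σ)
          (integrable_min_mul_abs_stdGaussian σ m), integral_const_mul, integral_abs_stdGaussian,
          truncGaussAbs]
    _ ≤ ∫ z, σ ^ 2 / (4 * m) * z ^ 2 ∂gaussianReal 0 1 :=
        integral_mono ((integrable_mul_abs_stdGaussian σ).sub
          (integrable_min_mul_abs_stdGaussian σ m)) (h_sq.const_mul _) (mul_abs_sub_min_le hm σ)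
    _ = σ ^ 2 / (4 * m) := by rw [integral_const_mul, integral_sq_stdGaussian, mul_one]

theorem stdGaussian_pdf_le (z : ℝ) : gaussianPDFReal 0 1 z ≤ 1 / 2 := by
  have h_sqrt : 2 ≤ √(2 * Real.pi * (1 : NNReal)) := by
    refine Real.le_sqrt_of_sq_le ?_
    rw [NNReal.coe_one, mul_one]
    linarith [Real.pi_gt_three]
  have h_exp : Real.exp (-(z - 0) ^ 2 / (2 * (1 : NNReal))) ≤ 1 :=
    Real.exp_le_one_iff.mpr
      (div_nonpos_of_nonpos_of_nonneg (neg_nonpos.mpr (sq_nonneg _)) (by positivity))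
  calc gaussianPDFReal 0 1 z ≤ (2 : ℝ)⁻¹ * 1 := by
        rw [gaussianPDFReal]
        gcongr
    _ = 1 / 2 := by norm_num

theorem stdGaussian_measureReal_le {s : Set ℝ} (hs : volume s ≠ ⊤) :
    (gaussianReal 0 1).real s ≤ 1 / 2 * volume.real s := by
  rw [Measure.real, gaussianReal_apply_eq_integral 0 one_ne_zero,
    ENNReal.toReal_ofReal (integral_nonneg (gaussianPDFReal_nonneg 0 1))]
  refine (Real.le_norm_self _).trans
    (norm_setIntegral_le_of_norm_le_const hs.lt_top fun z _ => ?_)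
  rw [Real.norm_of_nonneg (gaussianPDFReal_nonneg 0 1 z)]
  exact stdGaussian_pdf_le z

theorem sub_truncGaussAbs_le_sq_div_left {σ m : ℝ} (hσ : 0 < σ) (hm : 0 ≤ m) :
    m - truncGaussAbs σ m ≤ m ^ 2 / σ := by
  have h_pointwise (z : ℝ) : m - min m (σ * |z|) ≤
      (Set.Icc (-(m / σ)) (m / σ)).indicator (fun _ => m) z := by
    by_cases hz : |z| ≤ m / σ
    · rw [Set.indicator_of_mem (Set.mem_Icc.mpr (abs_le.mp hz)), sub_le_self_iff]
      positivity
    · rw [Set.indicator_of_notMem (mt (fun h => abs_le.mpr (Set.mem_Icc.mp h)) hz),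
        min_eq_left ((div_le_iff₀' hσ).mp (not_le.mp hz).le), sub_self]
  have h_length : volume.real (Set.Icc (-(m / σ)) (m / σ)) = 2 * (m / σ) := by
    rw [Real.volume_real_Icc_of_le (neg_le_self (by positivity)), sub_neg_eq_add, two_mul]
  calc m - truncGaussAbs σ m = ∫ z, (m - min m (σ * |z|)) ∂gaussianReal 0 1 := by
        rw [integral_sub (integrable_const m) (integrable_min_mul_abs_stdGaussian σ m),
          integral_const, probReal_univ, one_smul, truncGaussAbs]
    _ ≤ ∫ z, (Set.Icc (-(m / σ)) (m / σ)).indicator (fun _ => m) z ∂gaussianReal 0 1 :=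
        integral_mono ((integrable_const m).sub (integrable_min_mul_abs_stdGaussian σ m))
          ((integrable_const m).indicator measurableSet_Icc) h_pointwise
    _ = (gaussianReal 0 1).real (Set.Icc (-(m / σ)) (m / σ)) * m := by
        rw [integral_indicator_const _ measurableSet_Icc, smul_eq_mul]
    _ ≤ 1 / 2 * volume.real (Set.Icc (-(m / σ)) (m / σ)) * m := by
        gcongr
        exact stdGaussian_measureReal_le (by simp)
    _ = m ^ 2 / σ := by
        rw [h_length]
        ring

theorem truncGaussAbs_pos {σ m : ℝ} (hσ : 0 < σ) (hm : 0 < m) : 0 < truncGaussAbs σ m := by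
  have h_pos : 0 < min m (σ / 2) := lt_min hm (half_pos hσ)
  have h_half : min m (σ / 2) ^ 2 / σ ≤ min m (σ / 2) / 2 := by
    rw [div_le_div_iff₀ hσ two_pos, sq]
    nlinarith [min_le_right m (σ / 2)]
  have h_mono : truncGaussAbs σ (min m (σ / 2)) ≤ truncGaussAbs σ m :=
    integral_mono (integrable_min_mul_abs_stdGaussian σ _) (integrable_min_mul_abs_stdGaussian σ m)
      fun z => min_le_min_right _ (min_le_left _ _)
  linarith [sub_truncGaussAbs_le_sq_div_left hσ h_pos.le]

end TruncatedGaussian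

section WindowMass

theorem volume_Icc_sdiff_Icc {w : ℝ} (hw : 0 ≤ w) (u v : ℝ) :
    volume (Set.Icc (u - w) u \ Set.Icc (v - w) v) = ENNReal.ofReal (min w |u - v|) := by
  have h_add := measureReal_sdiff_add_inter (μ := volume) (s := Set.Icc (u - w) u)
    (t := Set.Icc (v - w) v) measurableSet_Icc (by simp)
  have h_inter : u ⊓ v - (u - w) ⊔ (v - w) = w - |u - v| := by
    rw [max_sub_sub_right, ← max_sub_min_eq_abs']
    ring
  rw [Set.Icc_inter_Icc, Real.volume_real_Icc, Real.volume_real_Icc, h_inter, sub_sub_cancel,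
    max_eq_left hw] at h_add
  rw [← ofReal_measureReal (measure_ne_top_of_subset Set.sdiff_subset (by simp)),
    eq_sub_of_add_eq h_add]
  congr 1
  rcases le_total w |u - v| with h_le | h_le
  · rw [max_eq_right (sub_nonpos.mpr h_le), min_eq_left h_le, sub_zero]
  · rw [max_eq_left (sub_nonneg.mpr h_le), min_eq_right h_le, sub_sub_cancel]

theorem measurableSet_mem_Icc_add (w : ℝ) :
    MeasurableSet {q : ℝ × ℝ | q.2 ∈ Set.Icc q.1 (w + q.1)} :=
  (measurableSet_le measurable_fst measurable_snd).inter
    (measurableSet_le measurable_snd (measurable_fst.const_add w))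

variable (μ : Measure ℝ) [IsProbabilityMeasure μ] {w : ℝ}

theorem lintegral_measure_Icc_mul_measure_compl (hw : 0 ≤ w) :
    ∫⁻ x, μ (Set.Icc x (w + x)) * μ (Set.Icc x (w + x))ᶜ =
      ∫⁻ p, ENNReal.ofReal (min w |p.1 - p.2|) ∂(μ.prod μ) := by
  let S : Set (ℝ × ℝ × ℝ) :=
    {q | q.2.1 ∈ Set.Icc q.1 (w + q.1) ∧ q.2.2 ∉ Set.Icc q.1 (w + q.1)}
  have hS : MeasurableSet S :=
    ((measurable_fst.prodMk measurable_snd.fst) (measurableSet_mem_Icc_add w)).inter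
      ((measurable_fst.prodMk measurable_snd.snd) (measurableSet_mem_Icc_add w)).compl
  have h_slice (x : ℝ) :
      Prod.mk x ⁻¹' S = Set.Icc x (w + x) ×ˢ (Set.Icc x (w + x))ᶜ := rfl
  have h_slice_symm (p : ℝ × ℝ) :
      (fun x => (x, p)) ⁻¹' S = Set.Icc (p.1 - w) p.1 \ Set.Icc (p.2 - w) p.2 := by
    ext x
    simp only [S, Set.mem_preimage, Set.mem_ofPred_eq, Set.mem_sdiff, Set.mem_Icc,
      sub_le_iff_le_add', and_comm]
  simp only [← Measure.prod_prod, ← volume_Icc_sdiff_Icc hw, ← h_slice, ← h_slice_symm]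
  rw [← Measure.prod_apply hS, Measure.prod_apply_symm hS]

theorem measurable_measure_Icc_mul_measure_compl (w : ℝ) :
    Measurable fun x => μ (Set.Icc x (w + x)) * μ (Set.Icc x (w + x))ᶜ :=
  (measurable_measure_prodMk_left (measurableSet_mem_Icc_add w)).mul
    (measurable_measure_prodMk_left (measurableSet_mem_Icc_add w).compl)

theorem integrable_min_abs_sub_prod (hw : 0 ≤ w) :
    Integrable (fun p : ℝ × ℝ => min w |p.1 - p.2|) (μ.prod μ) := by
  refine .of_bound (Measurable.aestronglyMeasurable (by fun_prop)) w (ae_of_all _ fun p => ?_)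
  rw [Real.norm_of_nonneg (le_min hw (abs_nonneg _))]
  exact min_le_left _ _

theorem toReal_measure_Icc_mul_measure_compl (x : ℝ) :
    (μ (Set.Icc x (w + x)) * μ (Set.Icc x (w + x))ᶜ).toReal =
      μ.real (Set.Icc x (w + x)) - μ.real (Set.Icc x (w + x)) ^ 2 := by
  rw [ENNReal.toReal_mul, ← measureReal_def, ← measureReal_def,
    probReal_compl_eq_one_sub measurableSet_Icc]
  ring

theorem integrable_measureReal_Icc_sub_sq (hw : 0 ≤ w) :
    Integrable fun x => μ.real (Set.Icc x (w + x)) - μ.real (Set.Icc x (w + x)) ^ 2 := by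
  simp only [← toReal_measure_Icc_mul_measure_compl]
  refine integrable_toReal_of_lintegral_ne_top
    (measurable_measure_Icc_mul_measure_compl μ w).aemeasurable ?_
  rw [lintegral_measure_Icc_mul_measure_compl μ hw]
  exact (integrable_min_abs_sub_prod μ hw).lintegral_lt_top.ne

theorem integral_measureReal_Icc_sub_sq (hw : 0 ≤ w) :
    ∫ x, (μ.real (Set.Icc x (w + x)) - μ.real (Set.Icc x (w + x)) ^ 2) =
      ∫ p, min w |p.1 - p.2| ∂(μ.prod μ) := by
  simp only [← toReal_measure_Icc_mul_measure_compl]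
  rw [integral_toReal (measurable_measure_Icc_mul_measure_compl μ w).aemeasurable
      (ae_of_all _ fun x => by finiteness),
    lintegral_measure_Icc_mul_measure_compl μ hw,
    integral_eq_lintegral_of_nonneg_ae (ae_of_all _ fun p => le_min hw (abs_nonneg _))
      (integrable_min_abs_sub_prod μ hw).aestronglyMeasurable]

end WindowMass

section Imod

theorem gaussWindow_eq_measureReal {c : ℝ} (hc : 0 ≤ c) (x : ℝ) :
    gaussWindow c x = (gaussianReal 0 1).real (Set.Icc x (2 * c + x)) := by
  have h_density (t : ℝ) :
      Real.exp (-t ^ 2 / 2) / √(2 * Real.pi) = gaussianPDFReal 0 1 t := by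
    rw [gaussianPDFReal, NNReal.coe_one, mul_one, mul_one, sub_zero, div_eq_inv_mul]
  rw [Measure.real, gaussianReal_apply_eq_integral 0 one_ne_zero,
    ENNReal.toReal_ofReal (integral_nonneg (gaussianPDFReal_nonneg 0 1)),
    integral_Icc_eq_integral_Ioc, ← intervalIntegral.integral_of_le (by linarith), gaussWindow]
  simp only [h_density]

theorem integrable_gaussWindow_sub_sq {c : ℝ} (hc : 0 ≤ c) :
    Integrable fun x : ℝ => gaussWindow c x - gaussWindow c x ^ 2 := by
  simpa only [gaussWindow_eq_measureReal hc] using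
    integrable_measureReal_Icc_sub_sq (gaussianReal 0 1) (mul_nonneg zero_le_two hc)

theorem map_sub_prod_gaussianReal (m n : ℝ) (v u : NNReal) :
    ((gaussianReal m v).prod (gaussianReal n u)).map (fun p => p.1 - p.2) =
      gaussianReal (m - n) (v + u) := by
  rw [sub_eq_add_neg, ← gaussianReal_conv_gaussianReal, ← gaussianReal_map_neg, Measure.conv]
  nth_rewrite 2 [← Measure.map_id (μ := gaussianReal m v)]
  rw [Measure.map_prod_map _ _ measurable_id measurable_neg,
    Measure.map_map measurable_add (by fun_prop)]
  rfl

theorem Imod_eq_truncGaussAbs {c : ℝ} (hc : 0 ≤ c) :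
    Imod c = √Real.pi * truncGaussAbs √2 (2 * c) := by
  have h_var : ((1 + 1 : NNReal) : ℝ) = 2 := by norm_num
  simp only [Imod, gaussWindow_eq_measureReal hc]
  rw [integral_measureReal_Icc_sub_sq _ (mul_nonneg zero_le_two hc), ← h_var,
    ← integral_min_abs_gaussianReal_zero, ← sub_zero (0 : ℝ), ← map_sub_prod_gaussianReal,
    integral_map (by fun_prop) (by fun_prop), h_var, sub_zero]

theorem Imod_nonneg {c : ℝ} (hc : 0 ≤ c) : 0 ≤ Imod c := by
  rw [Imod_eq_truncGaussAbs hc]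
  exact mul_nonneg (Real.sqrt_nonneg _)
    (truncGaussAbs_nonneg (Real.sqrt_nonneg _) (mul_nonneg zero_le_two hc))

theorem Imod_pos {c : ℝ} (hc : 0 < c) : 0 < Imod c := by
  rw [Imod_eq_truncGaussAbs hc.le]
  exact mul_pos (Real.sqrt_pos.mpr Real.pi_pos)
    (truncGaussAbs_pos (Real.sqrt_pos.mpr two_pos) (mul_pos two_pos hc))

theorem Imod_zero : Imod 0 = 0 := by
  rw [Imod_eq_truncGaussAbs le_rfl, mul_zero, truncGaussAbs_zero_right (Real.sqrt_nonneg _),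
    mul_zero]

theorem abs_Imod_sub_le {c d : ℝ} (hc : 0 ≤ c) (hd : 0 ≤ d) :
    |Imod c - Imod d| ≤ 2 * √Real.pi * |c - d| := by
  rw [Imod_eq_truncGaussAbs hc, Imod_eq_truncGaussAbs hd, ← mul_sub, abs_mul,
    abs_of_nonneg (Real.sqrt_nonneg _), mul_assoc, mul_left_comm]
  gcongr
  simpa [← mul_sub, abs_mul] using abs_truncGaussAbs_sub_le √2 √2 (2 * c) (2 * d)

theorem continuousOn_Imod : ContinuousOn Imod (Set.Ici 0) :=
  (LipschitzOnWith.of_dist_le_mul (K := ⟨2 * √Real.pi, by positivity⟩) fun _ hc _ hd =>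
    abs_Imod_sub_le hc hd).continuousOn

theorem tendsto_Imod_nhdsGT_zero : Tendsto Imod (𝓝[>] 0) (𝓝 0) := by
  have h_tendsto := (continuousOn_Imod 0 Set.self_mem_Ici).mono Set.Ioi_subset_Ici_self
  rwa [ContinuousWithinAt, Imod_zero] at h_tendsto

theorem sqrt_pi_mul_sqrt_two_mul : √Real.pi * (√2 * (√2 / √Real.pi)) = 2 := by
  rw [mul_div_assoc', Real.mul_self_sqrt zero_le_two]
  exact mul_div_cancel₀ 2 (Real.sqrt_ne_zero'.mpr Real.pi_pos)

theorem Imod_le_two {c : ℝ} (hc : 0 ≤ c) : Imod c ≤ 2 := by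
  rw [Imod_eq_truncGaussAbs hc]
  exact (mul_le_mul_of_nonneg_left (truncGaussAbs_le_left _ _)
    (Real.sqrt_nonneg _)).trans_eq sqrt_pi_mul_sqrt_two_mul

theorem two_sub_inv_le_Imod {c : ℝ} (hc : 0 < c) : 2 - √Real.pi / (4 * c) ≤ Imod c := by
  have h_trunc := sub_truncGaussAbs_le_sq_div (mul_pos two_pos hc) √2
  rw [sub_le_comm, Real.sq_sqrt zero_le_two, mul_left_comm, div_mul_cancel_left₀ two_ne_zero]
    at h_trunc
  calc 2 - √Real.pi / (4 * c) = √Real.pi * (√2 * (√2 / √Real.pi) - (4 * c)⁻¹) := by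
        rw [mul_sub, sqrt_pi_mul_sqrt_two_mul, div_eq_mul_inv]
    _ ≤ √Real.pi * truncGaussAbs √2 (2 * c) := by gcongr
    _ = Imod c := (Imod_eq_truncGaussAbs hc.le).symm

theorem tendsto_Imod_atTop : Tendsto Imod atTop (𝓝 2) := by
  have h_lower : Tendsto (fun c : ℝ => 2 - √Real.pi / (4 * c)) atTop (𝓝 2) := by
    simpa using (tendsto_const_nhds (x := (2 : ℝ))).sub
      ((tendsto_const_nhds (x := √Real.pi)).div_atTop (tendsto_id.const_mul_atTop four_pos))
  refine tendsto_of_tendsto_of_tendsto_of_le_of_le' h_lower tendsto_const_nhds ?_ ?_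
  · filter_upwards [eventually_gt_atTop 0] with c hc using two_sub_inv_le_Imod hc
  · filter_upwards [eventually_ge_atTop 0] with c hc using Imod_le_two hc

end Imod

section MainTerm

/-- The Gaussian approximation of the variance of the number of eigenvalues with modulus in
`[a, b]`, as a function of `p = √N a` and `q = √N b`: the two Poisson variables of parameters
`p ^ 2` and `q ^ 2` are replaced by Gaussian variables with the same means and variances. -/
noncomputable def varMain (p q : ℝ) : ℝ :=
  (p + q - √2 * √(p ^ 2 + q ^ 2)) / √Real.pi + truncGaussAbs √(p ^ 2 + q ^ 2) (q ^ 2 - p ^ 2)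

theorem abs_meanAbsDiff_poisson_self_sub_le {p : ℝ} (hp : 0 < p) {x : NNReal}
    (hx : (x : ℝ) = p ^ 2) :
    |meanAbsDiff (poissonMeasure x) (poissonMeasure x) / 2 - p / √Real.pi| ≤
      (8 + 4 * Real.pi) / absFourierConst / 2 := by
  have hx_pos : 0 < x := NNReal.coe_pos.mp (hx ▸ pow_pos hp 2)
  have h_gauss := abs_meanAbsDiff_poisson_sub_gaussianReal_le (add_pos hx_pos hx_pos)
  have h_moment : √((x + x : NNReal) : ℝ) * (√2 / √Real.pi) = 2 * (p / √Real.pi) := by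
    rw [NNReal.coe_add, hx, ← two_mul, Real.sqrt_mul zero_le_two, Real.sqrt_sq hp.le,
      mul_right_comm, mul_div_assoc', Real.mul_self_sqrt zero_le_two]
    ring
  rw [sub_self, integral_abs_gaussianReal_zero, h_moment] at h_gauss
  rw [← mul_div_cancel_left₀ (p / √Real.pi) two_ne_zero, ← sub_div, abs_div, abs_two]
  gcongr

theorem abs_energyDistance_poisson_sub_varMain_le {p q : ℝ} (hp : 0 < p) (hpq : p ≤ q)
    {x y : NNReal} (hx : (x : ℝ) = p ^ 2) (hy : (y : ℝ) = q ^ 2) :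
    |meanAbsDiff (poissonMeasure x) (poissonMeasure x) / 2 +
        meanAbsDiff (poissonMeasure y) (poissonMeasure y) / 2 -
        meanAbsDiff (poissonMeasure y) (poissonMeasure x) + y - x - varMain p q| ≤
      2 * ((8 + 4 * Real.pi) / absFourierConst) := by
  have hx_pos : 0 < x := NNReal.coe_pos.mp (hx ▸ pow_pos hp 2)
  have hxy : (x : ℝ) ≤ y := by rw [hx, hy]; gcongr
  have h_self_p := abs_meanAbsDiff_poisson_self_sub_le hp hx
  have h_self_q := abs_meanAbsDiff_poisson_self_sub_le (hp.trans_le hpq) hy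
  have h_cross := abs_meanAbsDiff_poisson_sub_gaussianReal_le (x := y)
    (add_pos_of_nonneg_of_pos zero_le hx_pos)
  have h_main : varMain p q = p / √Real.pi + q / √Real.pi -
      (√(p ^ 2 + q ^ 2) * (√2 / √Real.pi) - truncGaussAbs √(p ^ 2 + q ^ 2) (q ^ 2 - p ^ 2)) := by
    rw [varMain]
    ring
  rw [integral_abs_gaussianReal (sub_nonneg.mpr hxy), NNReal.coe_add, add_comm (y : ℝ), hx, hy]
    at h_cross
  rw [h_main, hx, hy]
  rw [abs_le] at *
  constructor <;> linarith

theorem abs_modulusVar_sub_varMain_le {N : ℕ} (hN : 0 < N) {a b : ℝ} (ha : 0 < a) (hab : a ≤ b)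
    (hb : b < 1) :
    |modulusVar N a b - varMain (√N * a) (√N * b)| ≤
      b ^ 2 / (4 * (1 - b ^ 2)) + 2 * ((8 + 4 * Real.pi) / absFourierConst) := by
  have : NeZero N := ⟨hN.ne'⟩
  have hN_pos : (0 : ℝ) < N := Nat.cast_pos.mpr hN
  have h_sqrt : 0 < √(N : ℝ) := Real.sqrt_pos.mpr hN_pos
  have h_sq (t : ℝ) : N * t ^ 2 = (√N * t) ^ 2 := by rw [mul_pow, Real.sq_sqrt hN_pos.le]
  let x : NNReal := ⟨N * a ^ 2, by positivity⟩
  let y : NNReal := ⟨N * b ^ 2, by positivity⟩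
  have hx : (x : ℝ) = N * a ^ 2 := rfl
  have hy : (y : ℝ) = N * b ^ 2 := rfl
  have hxy : (x : ℝ) ≤ y := by rw [hx, hy]; gcongr
  have hyN : (y : ℝ) < N :=
    mul_lt_of_lt_one_right hN_pos (pow_lt_one₀ (ha.le.trans hab) hb two_ne_zero)
  have h_tail : (y : ℝ) / (4 * (N - y)) = b ^ 2 / (4 * (1 - b ^ 2)) := by
    rw [hy, ← mul_one_sub, mul_left_comm, mul_div_mul_left _ _ hN_pos.ne']
  rw [modulusVar_eq_sum N ha.le hab, ← hx, ← hy, ← h_tail]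
  exact (abs_sub_le _ _ _).trans (add_le_add (abs_sum_poissonCdf_sub_le hxy hyN)
    (abs_energyDistance_poisson_sub_varMain_le (mul_pos h_sqrt ha)
      (mul_le_mul_of_nonneg_left hab h_sqrt.le) (hx.trans (h_sq a)) (hy.trans (h_sq b))))

theorem abs_add_sub_sqrt_two_mul_le {p q : ℝ} (hp : 0 ≤ p) (hpq : p ≤ q) :
    |p + q - √2 * √(p ^ 2 + q ^ 2)| ≤ q - p := by
  have h_lower : p + q ≤ √2 * √(p ^ 2 + q ^ 2) := by
    rw [← Real.sqrt_mul zero_le_two]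
    exact Real.le_sqrt_of_sq_le add_sq_le
  have h_upper : √2 * √(p ^ 2 + q ^ 2) ≤ 2 * q := by
    rw [← Real.sqrt_mul zero_le_two]
    exact Real.sqrt_le_iff.mpr ⟨by linarith, by nlinarith⟩
  rw [abs_le]
  constructor <;> linarith

theorem abs_sqrt_sub_sqrt_two_mul_le {p q : ℝ} (hp : 0 ≤ p) (hpq : p ≤ q) :
    |√(p ^ 2 + q ^ 2) - √2 * p| ≤ √2 * (q - p) := by
  have h_lower : √2 * p ≤ √(p ^ 2 + q ^ 2) := by
    refine Real.le_sqrt_of_sq_le ?_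
    rw [mul_pow, Real.sq_sqrt zero_le_two, two_mul]
    gcongr
  have h_upper : √(p ^ 2 + q ^ 2) ≤ √2 * q := by
    refine Real.sqrt_le_iff.mpr ⟨mul_nonneg (Real.sqrt_nonneg _) (hp.trans hpq), ?_⟩
    rw [mul_pow, Real.sq_sqrt zero_le_two, two_mul]
    gcongr
  rw [abs_of_nonneg (sub_nonneg.mpr h_lower), mul_sub]
  gcongr

theorem one_le_sqrt_pi : 1 ≤ √Real.pi :=
  Real.one_le_sqrt.mpr (by linarith [Real.pi_gt_three])

theorem abs_varMain_sub_truncGaussAbs_le {p q : ℝ} (hp : 0 ≤ p) (hpq : p ≤ q) :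
    |varMain p q - truncGaussAbs √(p ^ 2 + q ^ 2) (q ^ 2 - p ^ 2)| ≤ q - p := by
  rw [varMain, add_sub_cancel_right, abs_div, abs_of_nonneg (Real.sqrt_nonneg _)]
  exact (div_le_self (abs_nonneg _) one_le_sqrt_pi).trans (abs_add_sub_sqrt_two_mul_le hp hpq)

theorem abs_varMain_sub_add_div_le {p q : ℝ} (hp : 0 ≤ p) (hpq : p < q) :
    |varMain p q - (p + q) / √Real.pi| ≤ (p ^ 2 + q ^ 2) / (4 * (q ^ 2 - p ^ 2)) := by
  have h_split : varMain p q - (p + q) / √Real.pi =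
      -(√(p ^ 2 + q ^ 2) * (√2 / √Real.pi) -
        truncGaussAbs √(p ^ 2 + q ^ 2) (q ^ 2 - p ^ 2)) := by
    rw [varMain]
    ring
  have h_trunc := sub_truncGaussAbs_le_sq_div
    (sub_pos.mpr (pow_lt_pow_left₀ hpq hp two_ne_zero)) √(p ^ 2 + q ^ 2)
  rw [Real.sq_sqrt (by positivity)] at h_trunc
  rwa [h_split, abs_neg, abs_of_nonneg (sub_nonneg.mpr (truncGaussAbs_le_left _ _))]

theorem div_sqrt_pi_mul_Imod {p c : ℝ} (hp : 0 ≤ p) (hc : 0 ≤ c) :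
    p / √Real.pi * Imod c = truncGaussAbs (√2 * p) (2 * p * c) := by
  rw [Imod_eq_truncGaussAbs hc, ← mul_assoc,
    div_mul_cancel₀ _ (Real.sqrt_ne_zero'.mpr Real.pi_pos), mul_truncGaussAbs hp, mul_comm p,
    mul_left_comm, mul_assoc]

theorem abs_varMain_sub_Imod_le {p q : ℝ} (hp : 0 ≤ p) (hpq : p ≤ q) :
    |varMain p q - p / √Real.pi * Imod (q - p)| ≤ 3 * (q - p) + (q - p) ^ 2 := by
  have h_mean : |q ^ 2 - p ^ 2 - 2 * p * (q - p)| = (q - p) ^ 2 := by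
    rw [show q ^ 2 - p ^ 2 - 2 * p * (q - p) = (q - p) ^ 2 by ring, abs_sq]
  have h_deviation : |√(p ^ 2 + q ^ 2) - √2 * p| * (√2 / √Real.pi) ≤ 2 * (q - p) :=
    calc |√(p ^ 2 + q ^ 2) - √2 * p| * (√2 / √Real.pi)
        ≤ √2 * (q - p) * √2 := by
          gcongr
          · exact abs_sqrt_sub_sqrt_two_mul_le hp hpq
          · exact div_le_self (Real.sqrt_nonneg _) one_le_sqrt_pi
      _ = 2 * (q - p) := by rw [mul_right_comm, Real.mul_self_sqrt zero_le_two]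
  have h_trunc := abs_truncGaussAbs_sub_le √(p ^ 2 + q ^ 2) (√2 * p) (q ^ 2 - p ^ 2)
    (2 * p * (q - p))
  rw [div_sqrt_pi_mul_Imod hp (sub_nonneg.mpr hpq)]
  refine (abs_sub_le _ (truncGaussAbs √(p ^ 2 + q ^ 2) (q ^ 2 - p ^ 2)) _).trans ?_
  linarith [abs_varMain_sub_truncGaussAbs_le hp hpq]

theorem abs_varMain_sub_sq_sub_sq_le {p q : ℝ} (hp : 0 < p) (hpq : p ≤ q) :
    |varMain p q - (q ^ 2 - p ^ 2)| ≤ (q - p) + 2 * ((q - p) * (q ^ 2 - p ^ 2)) := by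
  have h_sq : 0 ≤ q ^ 2 - p ^ 2 := sub_nonneg.mpr (pow_le_pow_left₀ hp.le hpq 2)
  have h_sqrt : 0 < √(p ^ 2 + q ^ 2) := by positivity
  have h_add : q + p ≤ 2 * √(p ^ 2 + q ^ 2) := by
    rw [← sq_le_sq₀ (by linarith) (by positivity), mul_pow, Real.sq_sqrt (by positivity)]
    nlinarith [sq_nonneg (q - p)]
  have h_trunc : |truncGaussAbs √(p ^ 2 + q ^ 2) (q ^ 2 - p ^ 2) - (q ^ 2 - p ^ 2)| ≤
      2 * ((q - p) * (q ^ 2 - p ^ 2)) := by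
    rw [abs_sub_comm, abs_of_nonneg (sub_nonneg.mpr (truncGaussAbs_le_right _ _))]
    refine (sub_truncGaussAbs_le_sq_div_left h_sqrt h_sq).trans ?_
    rw [div_le_iff₀ h_sqrt]
    calc (q ^ 2 - p ^ 2) ^ 2 = (q + p) * ((q - p) * (q ^ 2 - p ^ 2)) := by ring
      _ ≤ 2 * √(p ^ 2 + q ^ 2) * ((q - p) * (q ^ 2 - p ^ 2)) :=
        mul_le_mul_of_nonneg_right h_add (mul_nonneg (sub_nonneg.mpr hpq) h_sq)
      _ = 2 * ((q - p) * (q ^ 2 - p ^ 2)) * √(p ^ 2 + q ^ 2) := by ring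
  exact (abs_sub_le _ _ _).trans
    (add_le_add (abs_varMain_sub_truncGaussAbs_le hp.le hpq) h_trunc)

end MainTerm

section Asymptotics

theorem tendsto_sqrt_natCast_atTop : Tendsto (fun N : ℕ => √(N : ℝ)) atTop atTop :=
  Real.tendsto_sqrt_atTop.comp tendsto_natCast_atTop_atTop

theorem isEquivalent_mul_of_isLittleO_sub {ι : Type*} {f : Filter ι} {u s v w : ι → ℝ} {l : ℝ}
    (hl : l ≠ 0) (hv : Tendsto v f (𝓝 l)) (hw : Tendsto w f (𝓝 l))
    (h : (fun i => u i - s i * v i) =o[f] s) : u ~[f] fun i => s i * w i := by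
  have hv_equiv : v ~[f] Function.const ι l := (isEquivalent_const_iff_tendsto hl).mpr hv
  have hw_equiv : w ~[f] Function.const ι l := (isEquivalent_const_iff_tendsto hl).mpr hw
  have h_bigO : s =O[f] fun i => s i * v i := by
    simpa only [mul_one] using
      (isBigO_refl s f).mul ((isBigO_const_const (1 : ℝ) hl f).trans hv_equiv.isBigO_symm)
  exact IsEquivalent.trans (h.trans_isBigO h_bigO)
    (IsEquivalent.refl.mul (hv_equiv.trans hw_equiv.symm))

variable {a b : ℕ → ℝ} {α β : ℝ}

theorem isBigO_modulusVar_sub_varMain (hα : 0 < α) (hβ : β < 1) (ha : Tendsto a atTop (𝓝 α))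
    (hb : Tendsto b atTop (𝓝 β)) (hab : ∀ᶠ N in atTop, a N ≤ b N) :
    (fun N : ℕ => modulusVar N (a N) (b N) - varMain (√N * a N) (√N * b N))
      =O[atTop] fun _ : ℕ => (1 : ℝ) := by
  have hβ_nonneg : 0 ≤ β := hα.le.trans (le_of_tendsto_of_tendsto ha hb hab)
  have h_tail : Tendsto (fun N => b N ^ 2 / (4 * (1 - b N ^ 2))) atTop
      (𝓝 (β ^ 2 / (4 * (1 - β ^ 2)))) :=
    (hb.pow 2).div (((hb.pow 2).const_sub 1).const_mul 4)
      (mul_ne_zero four_ne_zero (sub_pos.mpr (pow_lt_one₀ hβ_nonneg hβ two_ne_zero)).ne')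
  refine (IsBigO.of_norm_eventuallyLE ?_).trans ((h_tail.add_const
    (2 * ((8 + 4 * Real.pi) / absFourierConst))).isBigO_one ℝ)
  filter_upwards [eventually_gt_atTop 0, ha.eventually_const_lt hα, hab,
    hb.eventually_lt_const hβ] with N hN haN habN hbN
  exact abs_modulusVar_sub_varMain_le hN haN habN hbN

theorem isBigO_varMain_sub_sqrt_mul (hα : 0 < α) (ha : Tendsto a atTop (𝓝 α))
    (hb : Tendsto b atTop (𝓝 β)) (hab : ∀ᶠ N in atTop, a N < b N) :
    (fun N : ℕ => varMain (√N * a N) (√N * b N) - √(N : ℝ) * ((a N + b N) / √Real.pi))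
      =O[atTop] fun N => (b N - a N)⁻¹ := by
  have hβ : 0 < β :=
    hα.trans_le (le_of_tendsto_of_tendsto ha hb (hab.mono fun _ => le_of_lt))
  have h_factor : Tendsto (fun N => (a N ^ 2 + b N ^ 2) / (4 * (b N + a N))) atTop
      (𝓝 ((α ^ 2 + β ^ 2) / (4 * (β + α)))) :=
    ((ha.pow 2).add (hb.pow 2)).div ((hb.add ha).const_mul 4) (by positivity)
  have h_bound : (fun N => (a N ^ 2 + b N ^ 2) / (4 * (b N + a N)) * (b N - a N)⁻¹)
      =O[atTop] fun N => (b N - a N)⁻¹ := by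
    simpa only [one_mul] using (h_factor.isBigO_one ℝ).mul (isBigO_refl _ atTop)
  refine (IsBigO.of_norm_eventuallyLE ?_).trans h_bound
  filter_upwards [eventually_gt_atTop 0, ha.eventually_const_lt hα, hab] with N hN haN habN
  have hN_pos : (0 : ℝ) < N := Nat.cast_pos.mpr hN
  have h_sqrt : 0 < √(N : ℝ) := Real.sqrt_pos.mpr hN_pos
  have h_main := abs_varMain_sub_add_div_le (mul_pos h_sqrt haN).le
    (mul_lt_mul_of_pos_left habN h_sqrt)
  rw [← mul_add, mul_div_assoc] at h_main
  refine h_main.trans_eq ?_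
  rw [mul_pow, mul_pow, Real.sq_sqrt hN_pos.le, ← mul_add, ← mul_sub, mul_left_comm,
    mul_div_mul_left _ _ hN_pos.ne', sq_sub_sq, ← mul_assoc, ← div_div, div_eq_mul_inv _ (_ - _)]

theorem isBigO_modulusVar_sub_sqrt_mul (hα : 0 < α) (hβ : β < 1) (ha : Tendsto a atTop (𝓝 α))
    (hb : Tendsto b atTop (𝓝 β)) (hab : ∀ᶠ N in atTop, a N < b N) :
    (fun N : ℕ => modulusVar N (a N) (b N) - √(N : ℝ) * ((a N + b N) / √Real.pi))
      =O[atTop] fun N => (b N - a N)⁻¹ := by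
  have h_one : (fun _ : ℕ => (1 : ℝ)) =O[atTop] fun N => (b N - a N)⁻¹ := by
    refine (((hb.sub ha).isBigO_one ℝ).mul (isBigO_refl (fun N => (b N - a N)⁻¹) atTop)).congr' ?_
      (by simp only [one_mul, EventuallyEq.rfl])
    filter_upwards [hab] with N habN using mul_inv_cancel₀ (sub_pos.mpr habN).ne'
  exact (((isBigO_modulusVar_sub_varMain hα hβ ha hb (hab.mono fun _ => le_of_lt)).trans
    h_one).add (isBigO_varMain_sub_sqrt_mul hα ha hb hab)).congr_left
      fun N => sub_add_sub_cancel _ _ _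

theorem isEquivalent_modulusVar_of_tendsto_atTop (hα : 0 < α) (hα' : α < 1)
    (ha : Tendsto a atTop (𝓝 α)) (hb : Tendsto b atTop (𝓝 α)) (hab : ∀ᶠ N in atTop, a N < b N)
    (hs : Tendsto (fun N : ℕ => √(N : ℝ) * (b N - a N)) atTop atTop) :
    (fun N : ℕ => modulusVar N (a N) (b N))
      ~[atTop] fun N : ℕ => √(N : ℝ) * (2 * a N / √Real.pi) := by
  have h_littleO : (fun N => (b N - a N)⁻¹) =o[atTop] fun N : ℕ => √(N : ℝ) := by
    refine (isLittleO_iff_tendsto' ?_).mpr (hs.inv_tendsto_atTop.congr fun N => ?_)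
    · filter_upwards [tendsto_sqrt_natCast_atTop.eventually_gt_atTop 0] with N hN h_zero
      exact absurd h_zero hN.ne'
    · rw [Pi.inv_apply, mul_inv_rev, div_eq_mul_inv]
  refine isEquivalent_mul_of_isLittleO_sub (l := 2 * α / √Real.pi) (by positivity) ?_
    ((ha.const_mul 2).div_const _)
    ((isBigO_modulusVar_sub_sqrt_mul hα hα' ha hb hab).trans_isLittleO h_littleO)
  rw [two_mul]
  exact (ha.add hb).div_const _

theorem isBigO_modulusVar_sub_Imod (hα : 0 < α) (hα' : α < 1) (ha : Tendsto a atTop (𝓝 α))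
    (hb : Tendsto b atTop (𝓝 α)) (hab : ∀ᶠ N in atTop, a N < b N) {c : ℝ}
    (hs : Tendsto (fun N : ℕ => √(N : ℝ) * (b N - a N)) atTop (𝓝 c)) :
    (fun N : ℕ => modulusVar N (a N) (b N) -
        √(N : ℝ) * (a N / √Real.pi) * Imod (√(N : ℝ) * (b N - a N)))
      =O[atTop] fun _ : ℕ => (1 : ℝ) := by
  have h_main : (fun N : ℕ => varMain (√N * a N) (√N * b N) -
      √(N : ℝ) * (a N / √Real.pi) * Imod (√(N : ℝ) * (b N - a N)))
      =O[atTop] fun _ : ℕ => (1 : ℝ) := by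
    refine IsBigO.trans (IsBigO.of_norm_eventuallyLE ?_)
      (((hs.const_mul 3).add (hs.pow 2)).isBigO_one ℝ)
    filter_upwards [ha.eventually_const_lt hα, hab] with N haN habN
    have h_bound := abs_varMain_sub_Imod_le (mul_nonneg (Real.sqrt_nonneg N) haN.le)
      (mul_le_mul_of_nonneg_left habN.le (Real.sqrt_nonneg N))
    rwa [← mul_sub, mul_div_assoc] at h_bound
  exact ((isBigO_modulusVar_sub_varMain hα hα' ha hb (hab.mono fun _ => le_of_lt)).add
    h_main).congr_left fun N => sub_add_sub_cancel _ _ _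

theorem isEquivalent_modulusVar_Imod (hα : 0 < α) (hα' : α < 1) (ha : Tendsto a atTop (𝓝 α))
    (hb : Tendsto b atTop (𝓝 α)) (hab : ∀ᶠ N in atTop, a N < b N) {c : ℝ} (hc : 0 < c)
    (hs : Tendsto (fun N : ℕ => √(N : ℝ) * (b N - a N)) atTop (𝓝 c)) :
    (fun N : ℕ => modulusVar N (a N) (b N))
      ~[atTop] fun N : ℕ => √(N : ℝ) * (a N / √Real.pi) * Imod c := by
  have h_Imod : Tendsto (fun N : ℕ => Imod (√(N : ℝ) * (b N - a N))) atTop (𝓝 (Imod c)) :=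
    (continuousOn_Imod.continuousAt (Ici_mem_nhds hc)).tendsto.comp hs
  have h_littleO : (fun _ : ℕ => (1 : ℝ)) =o[atTop] fun N : ℕ => √(N : ℝ) :=
    (isLittleO_one_left_iff ℝ).mpr (tendsto_norm_atTop_atTop.comp tendsto_sqrt_natCast_atTop)
  have h_bigO := isBigO_modulusVar_sub_Imod hα hα' ha hb hab hs
  simp only [mul_assoc] at h_bigO ⊢
  exact isEquivalent_mul_of_isLittleO_sub (l := α / √Real.pi * Imod c)
    (mul_pos (by positivity) (Imod_pos hc)).ne' ((ha.div_const _).mul h_Imod)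
    ((ha.div_const _).mul_const _) (h_bigO.trans_isLittleO h_littleO)

theorem isBigO_modulusVar_sub_Imod_const (hα : 0 < α) (hα' : α < 1) (ha : Tendsto a atTop (𝓝 α))
    (hb : Tendsto b atTop (𝓝 α)) (hab : ∀ᶠ N in atTop, a N < b N) {c : ℝ}
    (hs : Tendsto (fun N : ℕ => √(N : ℝ) * (b N - a N)) atTop (𝓝 c))
    (h_rate : (fun N : ℕ => √(N : ℝ) * (b N - a N) - c) =O[atTop] fun N : ℕ => 1 / √(N : ℝ)) :
    (fun N : ℕ => modulusVar N (a N) (b N) - √(N : ℝ) * (a N / √Real.pi) * Imod c)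
      =O[atTop] fun _ : ℕ => (1 : ℝ) := by
  have h_nonneg : ∀ᶠ N : ℕ in atTop, 0 ≤ √(N : ℝ) * (b N - a N) :=
    hab.mono fun N habN => mul_nonneg (Real.sqrt_nonneg _) (sub_nonneg.mpr habN.le)
  have hc : 0 ≤ c := ge_of_tendsto hs h_nonneg
  have h_Imod : (fun N : ℕ => Imod (√(N : ℝ) * (b N - a N)) - Imod c)
      =O[atTop] fun N : ℕ => 1 / √(N : ℝ) := by
    refine (IsBigO.of_bound (2 * √Real.pi) ?_).trans h_rate
    filter_upwards [h_nonneg] with N hN using abs_Imod_sub_le hN hc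
  have h_mul : (fun N : ℕ => √(N : ℝ) * (a N / √Real.pi) *
      (Imod (√(N : ℝ) * (b N - a N)) - Imod c)) =O[atTop] fun _ : ℕ => (1 : ℝ) := by
    refine (((isBigO_refl (fun N : ℕ => √(N : ℝ)) atTop).mul
      ((ha.div_const √Real.pi).isBigO_one ℝ)).mul h_Imod).trans_eventuallyEq ?_
    filter_upwards [tendsto_sqrt_natCast_atTop.eventually_gt_atTop 0] with N hN
    rw [mul_one, mul_one_div_cancel hN.ne']
  refine ((isBigO_modulusVar_sub_Imod hα hα' ha hb hab hs).add h_mul).congr_left fun N => ?_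
  rw [mul_sub (√(N : ℝ) * (a N / √Real.pi)), sub_add_sub_cancel]

theorem isEquivalent_modulusVar_of_tendsto_zero (hα : 0 < α) (hα' : α < 1)
    (ha : Tendsto a atTop (𝓝 α)) (hb : Tendsto b atTop (𝓝 α)) (hab : ∀ᶠ N in atTop, a N < b N)
    (hN : Tendsto (fun N : ℕ => (N : ℝ) * (b N - a N)) atTop atTop)
    (hs : Tendsto (fun N : ℕ => √(N : ℝ) * (b N - a N)) atTop (𝓝 0)) :
    (fun N : ℕ => modulusVar N (a N) (b N))
      ~[atTop] fun N : ℕ => (N : ℝ) * (b N ^ 2 - a N ^ 2) := by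
  have h_atTop : Tendsto (fun N : ℕ => (N : ℝ) * (b N ^ 2 - a N ^ 2)) atTop atTop := by
    refine (hN.atTop_mul_pos (add_pos hα hα) (hb.add ha)).congr fun N => ?_
    ring
  have h_one : (fun _ : ℕ => (1 : ℝ)) =o[atTop] fun N : ℕ => (N : ℝ) * (b N ^ 2 - a N ^ 2) :=
    (isLittleO_one_left_iff ℝ).mpr (tendsto_norm_atTop_atTop.comp h_atTop)
  have h_prod : (fun N : ℕ => √(N : ℝ) * (b N - a N) * (N * (b N ^ 2 - a N ^ 2)))
      =o[atTop] fun N : ℕ => (N : ℝ) * (b N ^ 2 - a N ^ 2) := by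
    simpa only [one_mul] using ((isLittleO_one_iff ℝ).mpr hs).mul_isBigO (isBigO_refl _ _)
  have h_main : (fun N : ℕ => varMain (√N * a N) (√N * b N) - N * (b N ^ 2 - a N ^ 2))
      =o[atTop] fun N : ℕ => (N : ℝ) * (b N ^ 2 - a N ^ 2) := by
    refine IsBigO.trans_isLittleO (IsBigO.of_norm_eventuallyLE ?_)
      (((hs.isBigO_one ℝ).trans_isLittleO h_one).add (h_prod.const_mul_left 2))
    filter_upwards [eventually_gt_atTop 0, ha.eventually_const_lt hα, hab] with N hN haN habN
    have h_sqrt : 0 < √(N : ℝ) := Real.sqrt_pos.mpr (Nat.cast_pos.mpr hN)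
    have h_bound := abs_varMain_sub_sq_sub_sq_le (mul_pos h_sqrt haN)
      (mul_le_mul_of_nonneg_left habN.le h_sqrt.le)
    rwa [mul_pow, mul_pow, Real.sq_sqrt (Nat.cast_nonneg N), ← mul_sub, ← mul_sub] at h_bound
  exact (((isBigO_modulusVar_sub_varMain hα hα' ha hb (hab.mono fun _ => le_of_lt)).trans_isLittleO
    h_one).add h_main).congr_left fun N => sub_add_sub_cancel _ _ _

end Asymptotics

theorem theorem6 :
    -- fixed intervals
    (∀ a b : ℝ, 0 < a → a < b → b < 1 →
      (fun N : ℕ => modulusVar N a b - √(N : ℝ) * ((a + b) / √Real.pi))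
        =O[atTop] fun _ : ℕ => (1 : ℝ)) ∧
    -- intervals shrinking to an interior point
    (∀ (a b : ℕ → ℝ) (α : ℝ), 0 < α → α < 1 →
      Tendsto a atTop (𝓝 α) →
      Tendsto (fun N => b N - a N) atTop (𝓝 0) →
      Tendsto (fun N : ℕ => (N : ℝ) * (b N - a N)) atTop atTop →
      (Tendsto (fun N : ℕ => √(N : ℝ) * (b N - a N)) atTop atTop →
        (fun N : ℕ => modulusVar N (a N) (b N))
          ~[atTop] fun N : ℕ => √(N : ℝ) * (2 * a N / √Real.pi)) ∧
      (∀ c : ℝ, 0 < c →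
        Tendsto (fun N : ℕ => √(N : ℝ) * (b N - a N)) atTop (𝓝 c) →
        ((fun N : ℕ => modulusVar N (a N) (b N)
            - √(N : ℝ) * (a N / √Real.pi) * Imod (√(N : ℝ) * (b N - a N)))
          =O[atTop] fun _ : ℕ => (1 : ℝ)) ∧
        ((fun N : ℕ => modulusVar N (a N) (b N))
          ~[atTop] fun N : ℕ => √(N : ℝ) * (a N / √Real.pi) * Imod c) ∧
        (((fun N : ℕ => √(N : ℝ) * (b N - a N) - c)
            =O[atTop] fun N : ℕ => 1 / √(N : ℝ)) →
          (fun N : ℕ => modulusVar N (a N) (b N)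
              - √(N : ℝ) * (a N / √Real.pi) * Imod c)
            =O[atTop] fun _ : ℕ => (1 : ℝ))) ∧
      (Tendsto (fun N : ℕ => √(N : ℝ) * (b N - a N)) atTop (𝓝 0) →
        (fun N : ℕ => modulusVar N (a N) (b N))
          ~[atTop] fun N : ℕ => (N : ℝ) * (b N ^ 2 - a N ^ 2))) ∧
    -- the function `Imod`
    (∀ c : ℝ, 0 ≤ c →
      Integrable (fun x : ℝ => gaussWindow c x - gaussWindow c x ^ 2) ∧ 0 ≤ Imod c) ∧
    Tendsto Imod (𝓝[>] 0) (𝓝 0) ∧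
    Tendsto Imod atTop (𝓝 2) := by
  refine ⟨fun a b ha hab hb => ?_, fun a b α hα hα' ha hba hN => ?_,
    fun c hc => ⟨integrable_gaussWindow_sub_sq hc, Imod_nonneg hc⟩,
    tendsto_Imod_nhdsGT_zero, tendsto_Imod_atTop⟩
  · exact (isBigO_modulusVar_sub_sqrt_mul ha hb tendsto_const_nhds tendsto_const_nhds
      (.of_forall fun _ => hab)).trans (isBigO_const_const _ one_ne_zero _)
  · have hb : Tendsto b atTop (𝓝 α) := by simpa using ha.add hba
    have hab : ∀ᶠ N in atTop, a N < b N := by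
      filter_upwards [hN.eventually_gt_atTop 0] with N h_pos
      exact sub_pos.mp (pos_of_mul_pos_right h_pos N.cast_nonneg)
    exact ⟨isEquivalent_modulusVar_of_tendsto_atTop hα hα' ha hb hab,
      fun c hc hs => ⟨isBigO_modulusVar_sub_Imod hα hα' ha hb hab hs,
        isEquivalent_modulusVar_Imod hα hα' ha hb hab hc hs,
        isBigO_modulusVar_sub_Imod_const hα hα' ha hb hab hs⟩,
      isEquivalent_modulusVar_of_tendsto_zero hα hα' ha hb hab hN⟩
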